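/- **Setting.** Let $d,k,l\in\mathbb N$ with $d,k,l\ge 1$. Let $\Omega\subseteq\mathbb R^d$ be a bounded polyhedral Lipschitz domain, $\Gamma_D\subseteq\partial\Omega$ closed, $\Gamma_N=\partial\Omega\setminus\Gamma_D$, and let $\mathcal T_h$ be a conforming simplicial triangulation of $\overline\Omega$ (with closed elements $T$ and closed sides $S\in\mathcal S_h$) such that $\Gamma_D$ is a union of sides. Let $h_T=\operatorname{diam}T$, let $\rho_T$ be the diameter of the largest ball contained in $T$, and let $\mathcal T_h$ be shape regular with constant $\kappa$, i.e. $h_T\le\kappa\rho_T$ for all $T\in\mathcal T_h$. Let $\mathcal L^k(\mathcal T_h)^l$ be the space of functions $v_h\in L^\infty(\Omega;\mathbb R^l)$ whose restriction to each element is a (vector of) polynomials of degree at most $k$, and let $\mathcal S^k(\mathcal T_h)$ be the space of functions in $C^0(\overline\Omega)$ that are polynomials of degree at most $k$ on each element, with Lagrange nodes $\mathcal D_h^k$ (the points of elements whose barycentric coordinates are integer multiples of $1/k$) and nodal basis $(\varphi_z)_{z\in\mathcal D_h^k}$. The node-averaging operator is $\mathcal J_h^{av}v_h=\sum_{z\in\mathcal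 D_h^k}\langle v_h\rangle_z\varphi_z$, where $\langle v_h\rangle_z$ is the arithmetic mean of $(v_h|_{T})(z)$ over all elements $T$ containing $z$ if $z\in\Omega\cup\Gamma_N$, and $\langle v_h\rangle_z=0$ if $z\in\Gamma_D$. The element-wise gradient is $(\nabla_h^mv_h)|_T=\nabla^m(v_h|_T)$. The jump is $[v_h]_S=v_h|_{T_+}-v_h|_{T_-}$ if $S$ is the common side of two elements $T_\pm$, and $[v_h]_S=v_h|_T$ if $S\subseteq\partial\Omega$ is a side of $T$. Let $\omega_T$ be the union of all elements meeting $T$, and let $\mathcal S_h(T)$ be the set of all sides $S$ with $S\cap\operatorname{int}(\omega_T)\ne\emptyset$ together with all sides $S\subseteq\Gamma_D$ with $S\cap T\neq\emptyset$. An N-function is a convex $\varphi:[0,\infty)\to[0,\infty)$ with $\varphi(0)=0$, $\varphi(t)>0$ for $t>0$, $\lim_{t\to0}\varphi(t)/t=0$ and $\lim_{t\to\infty}\varphi(t)/t=\infty$. It satisfies $\Delta_2$ if $\varphi(2t)\le c\,\varphi(t)$ for some $c>0$ and all $t\ge0$; the smallest such $c$ is denoted by $\Delta_2(\varphi)$.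 It satisfies $\nabla_2$ if its conjugate $\varphi^*(s)=\sup_{t\ge0}(st-\varphi(t))$ is an N-function satisfying $\Delta_2$. With the right derivative $\varphi'$, let $\varphi_a(t)=\int_0^t\varphi'(a+s)\frac{s}{a+s}\,ds$ for $a,t\ge0$ and $c_\varphi=\sup_{a\ge0}\Delta_2(\varphi_a)$. **Proposition.** Let $\varphi$ be an N-function satisfying $\Delta_2$ and $\nabla_2$. Then for all $v_h\in\mathcal L^k(\mathcal T_h)^l$, $m\in\{1,\dots,k+1\}$, $a\ge0$ and $T\in\mathcal T_h$, $$\frac1{|T|}\int_T\varphi_a\big(h_T^m|\nabla_h^m(v_h-\mathcal J_h^{av}v_h)|\big)\,dx\le c\sum_{S\in\mathcal S_h(T)}\frac1{|S|}\int_S\varphi_a(|[v_h]_S|)\,ds,$$ where $|T|$ is the $d$-dimensional volume, $|S|$ and $ds$ refer to the $(d-1)$-dimensional surface measure (counting measure if $d=1$), $|\cdot|$ applied to vectors and tensors is the Euclidean norm, and where $c>0$ depends only on $d$, $k$, $l$, $c_\varphi$ and $\kappa$. -/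

import Mathlib

open MeasureTheory Set Topology
open scoped ENNReal NNReal

namespace NodeAveraging

noncomputable section

open scoped Classical

/-! ### N-functions

Functions on `[0, ∞)` are represented by functions on `ℝ` whose values on negative numbers are
never used. -/

/-- `φ : [0, ∞) → [0, ∞)` is an N-function. -/
structure IsNFunction (φ : ℝ → ℝ) : Prop where
  convexOn : ConvexOn ℝ (Ici 0) φ
  map_zero : φ 0 = 0
  pos : ∀ t, 0 < t → 0 < φ t
  tendsto_zero : Filter.Tendsto (fun t => φ t / t) (𝓝[>] 0) (𝓝 0)
  tendsto_top : Filter.Tendsto (fun t => φ t / t) Filter.atTop Filter.atTop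

/-- The `Δ₂`-condition. -/
def SatisfiesDelta2 (φ : ℝ → ℝ) : Prop :=
  ∃ c : ℝ, 0 < c ∧ ∀ t, 0 ≤ t → φ (2 * t) ≤ c * φ t

/-- The smallest constant in the `Δ₂`-condition (equal to `∞` if there is none). -/
def delta2Const (φ : ℝ → ℝ) : ℝ≥0∞ :=
  ⨅ (c : ℝ≥0) (_ : ∀ t, 0 ≤ t → φ (2 * t) ≤ c * φ t), (c : ℝ≥0∞)

/-- The Fenchel conjugate `φ^*(s) = sup_{t ≥ 0} (s t - φ(t))`. -/
def conjugate (φ : ℝ → ℝ) (s : ℝ) : ℝ :=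
  sSup ((fun t => s * t - φ t) '' Ici 0)

/-- The `∇₂`-condition. -/
def SatisfiesNabla2 (φ : ℝ → ℝ) : Prop :=
  IsNFunction (conjugate φ) ∧ SatisfiesDelta2 (conjugate φ)

/-- The right derivative of `φ`. -/
def rightDeriv (φ : ℝ → ℝ) (t : ℝ) : ℝ :=
  derivWithin φ (Ioi t) t

/-- The shifted N-function `φ_a(t) = ∫_0^t φ'(a + s) s / (a + s) ds`. -/
def shifted (φ : ℝ → ℝ) (a t : ℝ) : ℝ :=
  ∫ s in (0 : ℝ)..t, rightDeriv φ (a + s) * (s / (a + s))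

/-- `c_φ = sup_{a ≥ 0} Δ₂(φ_a)`. -/
def shiftedDelta2Const (φ : ℝ → ℝ) : ℝ≥0∞ :=
  ⨆ (a : ℝ) (_ : 0 ≤ a), delta2Const (shifted φ a)

/-! ### Lipschitz domains -/

/-- The Euclidean space `ℝ^d`. -/
abbrev Eu (d : ℕ) : Type := EuclideanSpace ℝ (Fin d)

/-- `Ω` is a bounded Lipschitz domain: a nonempty bounded connected open set which, near each of
its boundary points, is the strict epigraph of a Lipschitz function in the direction of some unit
vector `e`; here `y - ⟪e, y⟫ e` is the component of `y` orthogonal to `e`. -/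
structure IsLipschitzDomain {d : ℕ} (Ω : Set (Eu d)) : Prop where
  isOpen : IsOpen Ω
  isConnected : IsConnected Ω
  isBounded : Bornology.IsBounded Ω
  graph : ∀ x ∈ frontier Ω, ∃ e : Eu d, ‖e‖ = 1 ∧ ∃ (L : ℝ≥0) (g : Eu d → ℝ), LipschitzWith L g ∧
    ∃ U ∈ 𝓝 x, ∀ y ∈ U, y ∈ Ω ↔ g (y - inner ℝ e y • e) < inner ℝ e y

/-! ### Triangulations -/

/-- A conforming triangulation of `Ω`: a finite (geometric) simplicial complex with underlying
space the closure of `Ω`. Its simplices are given by their finite sets of vertices. -/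
structure Triangulation {d : ℕ} (Ω : Set (Eu d)) where
  complex : Geometry.SimplicialComplex ℝ (Eu d)
  finite_faces : complex.faces.Finite
  space_eq : complex.space = closure Ω

/-- The closed simplex with vertex set `s`. -/
def simplex {d : ℕ} (s : Finset (Eu d)) : Set (Eu d) := convexHull ℝ (s : Set (Eu d))

/-- The diameter of the largest ball contained in the simplex with vertex set `s`. -/
def inDiam {d : ℕ} (s : Finset (Eu d)) : ℝ :=
  sSup {ρ : ℝ | 0 ≤ ρ ∧ ∃ x, Metric.closedBall x (ρ / 2) ⊆ simplex s}

/-- `p : ℝ^d → ℝ` is a polynomial of degree at most `k`. -/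
def IsPoly {d : ℕ} (k : ℕ) (p : Eu d → ℝ) : Prop :=
  ∃ q : MvPolynomial (Fin d) ℝ, q.totalDegree ≤ k ∧
    ∀ x : Eu d, p x = MvPolynomial.eval (fun i => x i) q

/-- `p : ℝ^d → ℝ^l` is a vector of polynomials of degree at most `k`. -/
def IsPolyVec {d l : ℕ} (k : ℕ) (p : Eu d → Eu l) : Prop :=
  ∀ i : Fin l, IsPoly k (fun x => p x i)

/-- The restriction `v|_T` of `v ∈ ℒ^k(𝒯_h)^l` to the element `T`, as the (unique) polynomial that
agrees with `v` almost everywhere on `T`. -/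
def piece {d l : ℕ} (k : ℕ) (v : Eu d → Eu l) (T : Finset (Eu d)) : Eu d → Eu l :=
  Classical.epsilon fun p : Eu d → Eu l =>
    IsPolyVec k p ∧ ∀ᵐ x ∂(volume.restrict (simplex T)), v x = p x

namespace Triangulation

variable {d l : ℕ} {Ω : Set (Eu d)} (𝒯 : Triangulation Ω)

/-- The elements `T ∈ 𝒯_h`. -/
def elements : Finset (Finset (Eu d)) :=
  𝒯.finite_faces.toFinset.filter fun s => s.card = d + 1

/-- The sides `S ∈ 𝒮_h`, i.e. the `(d - 1)`-dimensional simplices. -/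
def sides : Finset (Finset (Eu d)) :=
  𝒯.finite_faces.toFinset.filter fun s => s.card = d

/-- Shape regularity: the ratio of the diameter of an element to the diameter of its largest
inscribed ball is at most `κ`. -/
def ShapeRegular (κ : ℝ) : Prop :=
  ∀ T ∈ 𝒯.elements, Metric.diam (simplex T) ≤ κ * inDiam T

/-- The set `Γ` is a union of sides. -/
def Resolves (Γ : Set (Eu d)) : Prop :=
  ∀ x ∈ Γ, ∃ S ∈ 𝒯.sides, x ∈ simplex S ∧ simplex S ⊆ Γ

/-- The patch `ω_T`, i.e. the union of all elements meeting `T`. -/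
def patch (T : Finset (Eu d)) : Set (Eu d) :=
  ⋃ T' ∈ 𝒯.elements.filter (fun T' => (simplex T' ∩ simplex T).Nonempty), simplex T'

/-- The set `𝒮_h(T)`: the sides meeting the (topological) interior of the patch `ω_T`, together
with the sides in the Dirichlet part `ΓD` of the boundary that meet `T`. -/
def sidesNear (ΓD : Set (Eu d)) (T : Finset (Eu d)) : Finset (Finset (Eu d)) :=
  𝒯.sides.filter fun S => (simplex S ∩ interior (𝒯.patch T)).Nonempty ∨
    (simplex S ⊆ ΓD ∧ (simplex S ∩ simplex T).Nonempty)

/-- `v ∈ ℒ^k(𝒯_h)^l`: on each element, `v` is (almost everywhere) polynomial of degree at most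
`k`. -/
def MemL (k : ℕ) (v : Eu d → Eu l) : Prop :=
  ∀ T ∈ 𝒯.elements, ∃ p : Eu d → Eu l, IsPolyVec k p ∧
    ∀ᵐ x ∂(volume.restrict (simplex T)), v x = p x

/-- `f ∈ 𝒮^k(𝒯_h)`: `f` is continuous on the closure of `Ω` and polynomial of degree at most `k`
on each element. -/
def MemS (k : ℕ) (f : Eu d → ℝ) : Prop :=
  ContinuousOn f (closure Ω) ∧
    ∀ T ∈ 𝒯.elements, ∃ p : Eu d → ℝ, IsPoly k p ∧ ∀ x ∈ simplex T, f x = p x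

/-- The degrees of freedom `𝒟_h^k` of the Lagrange element of order `k`: the points of the
elements whose barycentric coordinates are integer multiples of `1 / k`. -/
def nodes (k : ℕ) : Finset (Eu d) :=
  𝒯.elements.biUnion fun T =>
    (T.piAntidiag k).image fun α : Eu d → ℕ => ∑ y ∈ T, ((α y : ℝ) / (k : ℝ)) • y

/-- `f` is the nodal basis function `φ_z` of `𝒮^k(𝒯_h)`, which is unique on the closure of `Ω`. -/
def IsNodalBasisFunction (k : ℕ) (z : Eu d) (f : Eu d → ℝ) : Prop :=
  𝒯.MemS k f ∧ ∀ z' ∈ 𝒯.nodes k, f z' = if z' = z then 1 else 0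

theorem isPoly_affine (A : Eu d →ᵃ[ℝ] ℝ) : IsPoly 1 (fun x => A x) := by
  refine ⟨MvPolynomial.C (A 0) + ∑ i : Fin d, MvPolynomial.C (A.linear (EuclideanSpace.single i 1)) *
    MvPolynomial.X i, ?_, fun x => ?_⟩
  · refine (MvPolynomial.totalDegree_add _ _).trans (max_le (by simp) ?_)
    refine MvPolynomial.totalDegree_finsetSum_le fun i _ => ?_
    refine (MvPolynomial.totalDegree_mul _ _).trans (by simp)
  · have h1 : A x = A.linear x + A 0 := by
      have := A.map_vadd 0 x
      simpa using this
    have h2 : x = ∑ i : Fin d, x i • EuclideanSpace.single i (1 : ℝ) := by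
      ext j
      simp [Finset.sum_apply, Pi.single_apply]
    change A x = _
    rw [h1]
    conv_lhs => rw [h2]
    simp [mul_comm, add_comm]

theorem isPoly_prod {ι : Type*} (s : Finset ι) (n : ι → ℕ) (f : ι → Eu d → ℝ)
    (h : ∀ i ∈ s, IsPoly (n i) (f i)) : IsPoly (∑ i ∈ s, n i) (fun x => ∏ i ∈ s, f i x) := by
  choose! q hq hq' using h
  refine ⟨∏ i ∈ s, q i, ?_, fun x => ?_⟩
  · exact (MvPolynomial.totalDegree_finsetProd _ _).trans (Finset.sum_le_sum hq)
  · rw [map_prod]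
    exact Finset.prod_congr rfl fun i hi => hq' i hi x

/-- `w` is the family of barycentric coordinates of `x` with respect to the vertices. -/
def IsBary (x : Eu d) (w : Eu d → ℝ) : Prop :=
  ∃ s ∈ 𝒯.complex.faces, (∀ y ∈ s, 0 ≤ w y) ∧ (∀ y ∉ s, w y = 0) ∧ ∑ y ∈ s, w y = 1 ∧
    ∑ y ∈ s, w y • y = x

theorem weights_unique {s : Finset (Eu d)} (hs : AffineIndependent ℝ ((↑) : s → Eu d))
    {w w' : Eu d → ℝ} (h1 : ∑ y ∈ s, w y = ∑ y ∈ s, w' y)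
    (h2 : ∑ y ∈ s, w y • y = ∑ y ∈ s, w' y • y) : ∀ y ∈ s, w y = w' y := by
  intro y hy
  have := (affineIndependent_iff.1 hs) Finset.univ (fun y => w y - w' y)
    (by rw [Finset.sum_coe_sort s (fun y => w y - w' y), Finset.sum_sub_distrib, h1, sub_self])
    (by rw [Finset.sum_coe_sort s (fun y => (w y - w' y) • y)]
        simp only [sub_smul, Finset.sum_sub_distrib, h2, sub_self]) ⟨y, hy⟩ (Finset.mem_univ _)
  simpa [sub_eq_zero] using this

variable {𝒯} in
theorem IsBary.unique {x : Eu d} {w w' : Eu d → ℝ} (h : 𝒯.IsBary x w) (h' : 𝒯.IsBary x w') :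
    w = w' := by
  obtain ⟨s, hs, h0, h1, h2, h3⟩ := h
  obtain ⟨t, ht, h0', h1', h2', h3'⟩ := h'
  have hx : x ∈ convexHull ℝ (↑(s ∩ t) : Set (Eu d)) := by
    rw [Finset.coe_inter]
    exact 𝒯.complex.inter_subset_convexHull hs ht
      ⟨Finset.mem_convexHull'.2 ⟨w, h0, h2, h3⟩, Finset.mem_convexHull'.2 ⟨w', h0', h2', h3'⟩⟩
  obtain ⟨u, -, hu2, hu3⟩ := Finset.mem_convexHull'.1 hx
  let u' : Eu d → ℝ := fun y => if y ∈ s ∩ t then u y else 0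
  have key : ∀ r : Finset (Eu d), s ∩ t ⊆ r →
      ∑ y ∈ r, u' y = 1 ∧ ∑ y ∈ r, u' y • y = x := by
    intro r hr
    constructor
    · rw [← hu2, ← Finset.sum_subset hr]
      · exact Finset.sum_congr rfl fun y hy => if_pos hy
      · intro y _ hy; exact if_neg hy
    · rw [← hu3, ← Finset.sum_subset hr]
      · exact Finset.sum_congr rfl fun y hy => by simp only [u']; rw [if_pos hy]
      · intro y _ hy; simp only [u']; rw [if_neg hy, zero_smul]
  have e1 := weights_unique (𝒯.complex.indep hs) (w := w) (w' := u')
    (by rw [h2, (key s Finset.inter_subset_left).1])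
    (by rw [h3, (key s Finset.inter_subset_left).2])
  have e2 := weights_unique (𝒯.complex.indep ht) (w := w') (w' := u')
    (by rw [h2', (key t Finset.inter_subset_right).1])
    (by rw [h3', (key t Finset.inter_subset_right).2])
  have f1 : w = u' := by
    funext y
    by_cases hy : y ∈ s
    · exact e1 y hy
    · rw [h1 y hy]; exact (if_neg (by simp [hy])).symm
  have f2 : w' = u' := by
    funext y
    by_cases hy : y ∈ t
    · exact e2 y hy
    · rw [h1' y hy]; exact (if_neg (by simp [hy])).symm
  rw [f1, f2]

/-- The barycentric coordinates of `x` with respect to the vertices. -/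
def bary (x : Eu d) : Eu d → ℝ := Classical.epsilon (𝒯.IsBary x)

variable {𝒯} in
theorem IsBary.bary_eq {x : Eu d} {w : Eu d → ℝ} (h : 𝒯.IsBary x w) : 𝒯.bary x = w :=
  IsBary.unique (Classical.epsilon_spec ⟨w, h⟩) h

theorem bary_affine {s : Finset (Eu d)} (hs : s ∈ 𝒯.complex.faces) (y : Eu d) :
    ∃ A : Eu d →ᵃ[ℝ] ℝ, ∀ x ∈ simplex s, 𝒯.bary x y = A x := by
  have main : ∀ x ∈ simplex s, ∃ w : Eu d → ℝ, 𝒯.bary x = w ∧ (∀ y ∉ s, w y = 0) ∧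
      ∑ y ∈ s, w y = 1 ∧ ∑ y ∈ s, w y • y = x := by
    intro x hx
    obtain ⟨u, hu1, hu2, hu3⟩ := Finset.mem_convexHull'.1 hx
    have c1 : ∑ y ∈ s, (if y ∈ s then u y else 0) = 1 := by
      rw [← hu2]; exact Finset.sum_congr rfl fun y hy => if_pos hy
    have c2 : ∑ y ∈ s, (if y ∈ s then u y else 0) • y = x := by
      rw [← hu3]; exact Finset.sum_congr rfl fun y hy => by rw [if_pos hy]
    refine ⟨fun y => if y ∈ s then u y else 0, IsBary.bary_eq ⟨s, hs, ?_, ?_, c1, c2⟩, ?_, c1, c2⟩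
    · intro y hy; simpa [hy] using hu1 y hy
    · intro y hy; simp [hy]
    · intro y hy; simp [hy]
  by_cases hy : y ∈ s
  · obtain ⟨t, hst, ht, htop⟩ := exists_subset_affineIndependent_affineSpan_eq_top
      (k := ℝ) (s := (s : Set (Eu d))) (𝒯.complex.indep hs)
    let b : AffineBasis t ℝ (Eu d) := ⟨(↑), ht, by simpa using htop⟩
    have hyt : y ∈ t := hst hy
    refine ⟨b.coord ⟨y, hyt⟩, fun x hx => ?_⟩
    obtain ⟨w, hw, -, hw2, hw3⟩ := main x hx
    rw [hw]
    have hx' : b.coord ⟨y, hyt⟩ x = ∑ y' ∈ s, w y' * b.coord ⟨y, hyt⟩ y' := by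
      have e : s.affineCombination ℝ id w = x := by
        rw [Finset.affineCombination_eq_linear_combination s id w hw2]; simpa using hw3
      conv_lhs => rw [← e]
      rw [Finset.map_affineCombination s id w hw2 (b.coord ⟨y, hyt⟩),
        Finset.affineCombination_eq_linear_combination _ _ _ hw2]
      simp
    rw [hx', Finset.sum_eq_single y]
    · have := b.coord_apply_eq ⟨y, hyt⟩
      have h' : b ⟨y, hyt⟩ = y := rfl
      rw [h'] at this
      rw [this, mul_one]
    · intro y' hy' hne
      have := b.coord_apply_ne (i := ⟨y, hyt⟩) (j := ⟨y', hst hy'⟩)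
        (by simpa [Subtype.ext_iff] using hne.symm)
      have h' : b ⟨y', hst hy'⟩ = y' := rfl
      rw [h'] at this
      rw [this, mul_zero]
    · intro h; exact absurd hy h
  · refine ⟨AffineMap.const ℝ _ 0, fun x hx => ?_⟩
    obtain ⟨w, hw, hw1, -⟩ := main x hx
    rw [hw, hw1 y hy]; rfl

theorem mem_elements {T : Finset (Eu d)} :
    T ∈ 𝒯.elements ↔ T ∈ 𝒯.complex.faces ∧ T.card = d + 1 := by
  simp [elements]

theorem bary_node {k : ℕ} (hk : 1 ≤ k) {T : Finset (Eu d)} (hT : T ∈ 𝒯.elements)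
    {α : Eu d → ℕ} (hα : α ∈ T.piAntidiag k) (y : Eu d) :
    𝒯.bary (∑ y ∈ T, ((α y : ℝ) / (k : ℝ)) • y) y = (α y : ℝ) / k := by
  rw [Finset.mem_piAntidiag] at hα
  have : 𝒯.IsBary (∑ y ∈ T, ((α y : ℝ) / (k : ℝ)) • y) (fun y => (α y : ℝ) / k) := by
    refine ⟨T, (𝒯.mem_elements.1 hT).1, fun y _ => by positivity, fun y hy => ?_, ?_, rfl⟩
    · have : α y = 0 := by by_contra h; exact hy (hα.2 y h)
      simp [this]
    · rw [← Finset.sum_div, ← Nat.cast_sum, hα.1]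
      exact div_self (by positivity)
  rw [this.bary_eq]

theorem exists_nodalBasisFunction {k : ℕ} (hk : 1 ≤ k) {z : Eu d} (hz : z ∈ 𝒯.nodes k) :
    ∃ f, 𝒯.IsNodalBasisFunction k z f := by
  have hk0 : (k : ℝ) ≠ 0 := by positivity
  simp only [nodes, Finset.mem_biUnion, Finset.mem_image] at hz
  obtain ⟨T, hT, α, hα, rfl⟩ := hz
  have hα' := Finset.mem_piAntidiag.1 hα
  let f : Eu d → ℝ := fun x =>
    ∏ y ∈ T, ∏ j ∈ Finset.range (α y), ((k : ℝ) * 𝒯.bary x y - j) / (j + 1)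
  have loc : ∀ s ∈ 𝒯.complex.faces, ∃ p : Eu d → ℝ, IsPoly k p ∧ ∀ x ∈ simplex s, f x = p x := by
    intro s hs
    choose A hA using 𝒯.bary_affine hs
    refine ⟨fun x => ∏ y ∈ T, ∏ j ∈ Finset.range (α y), ((k : ℝ) * A y x - j) / (j + 1), ?_, ?_⟩
    · have := isPoly_prod T α
        (fun y x => ∏ j ∈ Finset.range (α y), ((k : ℝ) * A y x - j) / (j + 1)) fun y _ => by
          have := isPoly_prod (Finset.range (α y)) (fun _ => 1)
            (fun j x => ((k : ℝ) * A y x - j) / (j + 1)) fun j _ => by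
              have := isPoly_affine ((((j : ℝ) + 1)⁻¹) • ((k : ℝ) • A y - AffineMap.const ℝ _ (j : ℝ)))
              simpa [div_eq_inv_mul] using this
          simpa using this
      rwa [hα'.1] at this
    · intro x hx
      simp only [f, hA _ x hx]
  refine ⟨f, ⟨?_, fun s hs => loc s (𝒯.mem_elements.1 hs).1⟩, ?_⟩
  · have hc : closure Ω = ⋃ s : 𝒯.complex.faces, simplex (s : Finset (Eu d)) := by
      rw [← 𝒯.space_eq, Geometry.SimplicialComplex.space, biUnion_eq_iUnion]; rfl
    have : Finite 𝒯.complex.faces := 𝒯.finite_faces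
    rw [hc]
    refine (locallyFinite_of_finite _).continuousOn_iUnion
      (fun s => ((s : Finset (Eu d)).finite_toSet.isCompact_convexHull ℝ).isClosed) fun s => ?_
    obtain ⟨p, ⟨q, -, hq⟩, hp⟩ := loc s s.2
    refine ContinuousOn.congr (f := p) (Continuous.continuousOn ?_) hp
    have : p = fun x : Eu d => MvPolynomial.eval (fun i => x i) q := funext hq
    rw [this]
    exact (MvPolynomial.continuous_eval q).comp (by fun_prop)
  · intro z' hz'
    simp only [nodes, Finset.mem_biUnion, Finset.mem_image] at hz'
    obtain ⟨T', hT', β, hβ, rfl⟩ := hz'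
    have hβ' := Finset.mem_piAntidiag.1 hβ
    have hf : f (∑ y ∈ T', ((β y : ℝ) / (k : ℝ)) • y) =
        ∏ y ∈ T, ∏ j ∈ Finset.range (α y), ((β y : ℝ) - j) / (j + 1) := by
      simp only [f, 𝒯.bary_node hk hT' hβ, mul_div_cancel₀ _ hk0]
    rw [hf]
    split_ifs with h
    · have hab : ∀ y, (α y : ℝ) = β y := fun y => by
        have h1 := 𝒯.bary_node hk hT' hβ y
        rw [h, 𝒯.bary_node hk hT hα y] at h1
        field_simp at h1
        exact h1
      refine Finset.prod_eq_one fun y _ => ?_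
      rw [← hab, Finset.prod_div_distrib, div_eq_one_iff_eq]
      · rw [← Finset.prod_range_reflect]
        refine Finset.prod_congr rfl fun j hj => ?_
        rw [Finset.mem_range] at hj
        have : α y - 1 - j + (j + 1) = α y := by omega
        rw [← this]; push_cast
        have e : α y - 1 - j + (j + 1) - 1 - j = α y - 1 - j := by omega
        rw [e]; ring
      · exact Finset.prod_ne_zero_iff.2 fun j _ => by positivity
    · have hlt : ∃ y ∈ T, β y < α y := by
        by_contra! hle
        apply h
        have hsub : ∑ y ∈ T, β y ≤ k := by
          rw [← hβ'.1]
          calc ∑ y ∈ T, β y ≤ ∑ y ∈ T ∪ T', β y :=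
                Finset.sum_le_sum_of_subset Finset.subset_union_left
            _ = ∑ y ∈ T', β y := (Finset.sum_subset Finset.subset_union_right
                fun y _ hy => by by_contra hne; exact hy (hβ'.2 y hne)).symm
        have heq : ∀ y ∈ T, α y = β y :=
          (Finset.sum_eq_sum_iff_of_le hle).1
            (le_antisymm (Finset.sum_le_sum hle) (by rw [hα'.1]; exact hsub))
        have heq' : ∑ y ∈ T, β y = k := by rw [← hα'.1]; exact (Finset.sum_congr rfl heq).symm
        have hz0 : ∀ y ∉ T, β y = 0 := by
          intro y hy
          by_contra hne
          have : ∑ y ∈ insert y T, β y ≤ ∑ y ∈ T', β y := by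
            calc ∑ y ∈ insert y T, β y ≤ ∑ y ∈ insert y T ∪ T', β y :=
                Finset.sum_le_sum_of_subset Finset.subset_union_left
            _ = ∑ y ∈ T', β y := (Finset.sum_subset Finset.subset_union_right
                fun y _ hy => by by_contra hne; exact hy (hβ'.2 y hne)).symm
          rw [Finset.sum_insert hy, heq', hβ'.1] at this
          omega
        have hab : α = β := by
          funext y
          by_cases hy : y ∈ T
          · exact heq y hy
          · rw [hz0 y hy]; by_contra hne; exact hy (hα'.2 y hne)
        subst hab
        rw [Finset.sum_subset (Finset.subset_union_left (s₁ := T) (s₂ := T')),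
          Finset.sum_subset (Finset.subset_union_right (s₁ := T) (s₂ := T'))]
        · intro y _ hy
          have : α y = 0 := by by_contra hne; exact hy (hβ'.2 y hne)
          simp [this]
        · intro y _ hy
          have : α y = 0 := by by_contra hne; exact hy (hα'.2 y hne)
          simp [this]
      obtain ⟨y, hy, hlt⟩ := hlt
      refine Finset.prod_eq_zero hy (Finset.prod_eq_zero (Finset.mem_range.2 hlt) ?_)
      simp

/-- The nodal basis function `φ_z`. -/
def nodalBasis (k : ℕ) (z : Eu d) : Eu d → ℝ :=
  Classical.epsilon (𝒯.IsNodalBasisFunction k z)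

theorem nodalBasis_spec {k : ℕ} (hk : 1 ≤ k) {z : Eu d} (hz : z ∈ 𝒯.nodes k) :
    𝒯.IsNodalBasisFunction k z (𝒯.nodalBasis k z) :=
  Classical.epsilon_spec (𝒯.exists_nodalBasisFunction hk hz)

/-- The set `𝒯_h(z)` of the elements containing `z`. -/
def elementsAt (z : Eu d) : Finset (Finset (Eu d)) :=
  𝒯.elements.filter fun T => z ∈ simplex T

/-- The nodal value `⟨v⟩_z`. -/
def nodalAverage (k : ℕ) (ΓD : Set (Eu d)) (v : Eu d → Eu l) (z : Eu d) : Eu l :=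
  if z ∈ ΓD then 0
  else ((𝒯.elementsAt z).card : ℝ)⁻¹ • ∑ T ∈ 𝒯.elementsAt z, piece k v T z

/-- The node-averaging operator `J_h^av`. -/
def nodeAveraging (k : ℕ) (ΓD : Set (Eu d)) (v : Eu d → Eu l) (x : Eu d) : Eu l :=
  ∑ z ∈ 𝒯.nodes k, 𝒯.nodalBasis k z x • 𝒯.nodalAverage k ΓD v z

/-- The jump of `v` across the side `S`: the trace of `v` from the only adjacent element if `S` lies
on the boundary of `Ω`, and the difference of the traces from the two adjacent elements, in some
order, otherwise. -/
def jump (k : ℕ) (v : Eu d → Eu l) (S : Finset (Eu d)) (x : Eu d) : Eu l :=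
  if simplex S ⊆ frontier Ω then
    piece k v (Classical.epsilon fun T => T ∈ 𝒯.elements ∧ S ⊆ T) x
  else
    let P : Finset (Eu d) × Finset (Eu d) := Classical.epsilon fun P =>
      P.1 ∈ 𝒯.elements ∧ P.2 ∈ 𝒯.elements ∧ P.1 ≠ P.2 ∧ S ⊆ P.1 ∧ S ⊆ P.2
    piece k v P.1 x - piece k v P.2 x

end Triangulation

/-- The Euclidean norm `|∇^m p(x)|` of the tensor of all `m`-th order partial derivatives. -/
def gradNorm {d l : ℕ} (m : ℕ) (p : Eu d → Eu l) (x : Eu d) : ℝ :=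
  √(∑ j : Fin m → Fin d,
    ‖iteratedFDeriv ℝ m p x (fun i => EuclideanSpace.single (j i) (1 : ℝ))‖ ^ 2)

end

end NodeAveraging

/-!
On an element `T` the error `w = v - J v` of node averaging is a polynomial of degree at most `k`,
and the proof bounds its derivatives by one single jump, namely the largest one, `R`, in the sides
near `T`. Only at the end does the shifted N-function `ψ = φ_a` enter, and only through monotonicity
and doubling.

*From derivatives to nodal values.* On lines, a polynomial agrees with its one-dimensional Lagrange
interpolation (`IsLineInterp`). This gives Markov's inequality for the derivative in directions
that point from one point of `T` to another, hence in all directions, since `T` contains a ball of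
radius comparable to its diameter (`IsLineInterp.norm_iteratedFDeriv_le`). The values of `w` on `T`
are bounded by its values at the Lagrange nodes of `T` (`IsPolyVec.norm_le_of_nodes`), because the
nodes are unisolvent for the homogeneous polynomials of degree `k` in the barycentric coordinates.

*From nodal values to jumps.* At a node `z` of `T`, the value `w z` is the difference between the
trace of `v` from `T` and the average of the traces from all elements at `z`, or just the trace
from `T` if `z` is in the Dirichlet part. Any two elements at `z` are connected by a chain of
elements at `z` in which consecutive ones share a side (`Triangulation.reachable_sideGraph`); here
the Lipschitz property of the domain is used, which also shows that a shared side does not lie in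
the boundary. The difference of two traces is therefore a sum of jumps at `z`. The number of
elements at `z` is bounded by a comparison of volumes
(`Triangulation.ShapeRegular.card_elementsAt_le`). Together, `‖w z‖` is at most a constant times `R`
(`Triangulation.norm_piece_sub_nodalAverage_le`).

*From point values of jumps to averages.* If the norm of the jump across a side `S` attains its
maximum over `S` at `x`, then by the one-dimensional estimate it is at least half of the maximum on
the image of `S` under a contraction with center `x`. That image is a fixed fraction of `S`, so that
doubling bounds `ψ R` by the average of `ψ` of the jump (`IsDoubling.le_setAverage`).

The doubling constant of `ψ` is at most `c_φ`, which is finite since `φ` satisfies the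
`Δ₂`-condition (`isDoubling_shifted`).
-/

namespace NodeAveraging

noncomputable section

open scoped Classical

/-! ### Polynomials on lines -/

/-- The Lagrange basis polynomial of degree `k` in one variable that belongs to the node `i / k`
among the equidistant nodes `0, 1 / k, …, 1` of the unit interval. -/
def lineBasis (k i : ℕ) : Polynomial ℝ :=
  Lagrange.basis (Finset.range (k + 1)) (fun j : ℕ => (j : ℝ) / k) i

theorem line_nodes_injOn {k : ℕ} (hk : 1 ≤ k) :
    Set.InjOn (fun j : ℕ => (j : ℝ) / k) (Finset.range (k + 1) : Finset ℕ) := by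
  intro i _ j _ h
  have hk0 : (k : ℝ) ≠ 0 := by positivity
  simp only at h
  field_simp at h
  exact_mod_cast h

theorem eval_eq_sum_lineBasis {k : ℕ} (hk : 1 ≤ k) {q : Polynomial ℝ} (hq : q.natDegree ≤ k)
    (t : ℝ) :
    q.eval t = ∑ i ∈ Finset.range (k + 1), (lineBasis k i).eval t * q.eval ((i : ℝ) / k) := by
  have h := Lagrange.eq_interpolate (f := q) (line_nodes_injOn hk) (by
    rw [Finset.card_range]
    exact (Polynomial.degree_le_natDegree).trans_lt (by exact_mod_cast Nat.lt_succ_of_le hq))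
  conv_lhs => rw [h]
  simp [Lagrange.interpolate_apply, Polynomial.eval_finsetSum, lineBasis, mul_comm]

/-- On each line, `p` is given by its Lagrange interpolation of degree `k` in equidistant points.
This is how the degree bound on a polynomial enters the estimates of this file. The property is
stable under translations and linear combinations, in particular under differentiation. -/
def IsLineInterp {E F : Type*} [AddCommGroup E] [Module ℝ E] [AddCommGroup F] [Module ℝ F]
    (k : ℕ) (p : E → F) : Prop :=
  ∀ (x u : E) (t : ℝ), p (x + t • u) =
    ∑ i ∈ Finset.range (k + 1), (lineBasis k i).eval t • p (x + ((i : ℝ) / k) • u)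

theorem IsPoly.exists_line {d k : ℕ} {p : Eu d → ℝ} (hp : IsPoly k p) (x u : Eu d) :
    ∃ q : Polynomial ℝ, q.natDegree ≤ k ∧ ∀ t, p (x + t • u) = q.eval t := by
  obtain ⟨q, hq, hpq⟩ := hp
  refine ⟨MvPolynomial.aeval (fun i => Polynomial.C (x i) + Polynomial.C (u i) * Polynomial.X) q,
    ?_, fun t => ?_⟩
  · refine (MvPolynomial.aeval_natDegree_le (m := k) (n := 1) q hq _ fun i => ?_).trans (by simp)
    refine (Polynomial.natDegree_add_le _ _).trans (max_le (by simp) ?_)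
    exact (Polynomial.natDegree_C_mul_le _ _).trans Polynomial.natDegree_X_le
  · have h := MvPolynomial.comp_aeval_apply (R := ℝ)
      (f := fun i => Polynomial.C (x i) + Polynomial.C (u i) * Polynomial.X) (Polynomial.aeval t) q
    rw [Polynomial.coe_aeval_eq_eval] at h
    rw [hpq, h]
    change _ = MvPolynomial.eval _ q
    congr 2
    funext i
    simp only [PiLp.add_apply, PiLp.smul_apply, smul_eq_mul, Polynomial.eval_add,
      Polynomial.eval_mul, Polynomial.eval_C, Polynomial.eval_X]
    ring

theorem IsPolyVec.isLineInterp {d l k : ℕ} (hk : 1 ≤ k) {p : Eu d → Eu l} (hp : IsPolyVec k p) :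
    IsLineInterp k p := by
  intro x u t
  ext i
  obtain ⟨q, hq, h⟩ := (hp i).exists_line x u
  simp only [WithLp.ofLp_sum, Finset.sum_apply, WithLp.ofLp_smul, Pi.smul_apply,
    smul_eq_mul, h]
  exact eval_eq_sum_lineBasis hk hq t

theorem contDiff_mvPolynomial_eval {d : ℕ} (q : MvPolynomial (Fin d) ℝ) :
    ContDiff ℝ ⊤ (fun x : Eu d => MvPolynomial.eval (fun i => x i) q) := by
  induction q using MvPolynomial.induction_on with
  | C a => simpa using contDiff_const
  | add p q hp hq => simpa using hp.add hq
  | mul_X p i hp =>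
    simp only [map_mul, MvPolynomial.eval_X]
    exact hp.mul (contDiff_piLp_apply 2)

theorem IsPolyVec.contDiff {d l k : ℕ} {p : Eu d → Eu l} (hp : IsPolyVec k p) :
    ContDiff ℝ ⊤ p := by
  rw [contDiff_euclidean]
  intro i
  obtain ⟨q, -, hq⟩ := hp i
  rw [funext hq]
  exact contDiff_mvPolynomial_eval q

/-- A bound for all coefficients of the one-dimensional Lagrange basis polynomials together. -/
def lineConst (k : ℕ) : ℝ :=
  ∑ i ∈ Finset.range (k + 1), ∑ j ∈ (lineBasis k i).support, |(lineBasis k i).coeff j|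

theorem lineConst_nonneg (k : ℕ) : 0 ≤ lineConst k :=
  Finset.sum_nonneg fun _ _ => Finset.sum_nonneg fun _ _ => abs_nonneg _

theorem abs_eval_sub_eval_zero_le (q : Polynomial ℝ) {t : ℝ} (h0 : 0 ≤ t) (h1 : t ≤ 1) :
    |q.eval t - q.eval 0| ≤ t * ∑ j ∈ q.support, |q.coeff j| := by
  rw [Polynomial.eval_eq_sum, Polynomial.eval_eq_sum, Polynomial.sum, Polynomial.sum,
    ← Finset.sum_sub_distrib, Finset.mul_sum]
  refine (Finset.abs_sum_le_sum_abs _ _).trans (Finset.sum_le_sum fun j _ => ?_)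
  rw [← mul_sub, abs_mul, mul_comm]
  refine mul_le_mul_of_nonneg_right ?_ (abs_nonneg _)
  rcases j with _ | j
  · simpa using h0
  · rw [zero_pow (Nat.succ_ne_zero j), sub_zero, abs_of_nonneg (by positivity), pow_succ]
    exact mul_le_of_le_one_left h0 (pow_le_one₀ h0 h1)

theorem abs_derivative_eval_zero_le (q : Polynomial ℝ) :
    |q.derivative.eval 0| ≤ ∑ j ∈ q.support, |q.coeff j| := by
  rw [← Polynomial.coeff_zero_eq_eval_zero, Polynomial.coeff_derivative]
  simp only [zero_add, Nat.cast_zero, mul_one]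
  by_cases h : 1 ∈ q.support
  · exact Finset.single_le_sum (f := fun j => |q.coeff j|) (fun _ _ => abs_nonneg _) h
  · rw [Polynomial.notMem_support_iff.1 h, abs_zero]
    exact Finset.sum_nonneg fun _ _ => abs_nonneg _

section

variable {E F : Type*} [NormedAddCommGroup E] [NormedSpace ℝ E] [NormedAddCommGroup F]
  [NormedSpace ℝ F] {k : ℕ} {p : E → F}

theorem IsLineInterp.norm_add_smul_sub_le (hp : IsLineInterp k p) {x u : E} {M : ℝ}
    (hM : ∀ s : ℝ, 0 ≤ s → s ≤ 1 → ‖p (x + s • u)‖ ≤ M) {t : ℝ} (h0 : 0 ≤ t) (h1 : t ≤ 1) :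
    ‖p (x + t • u) - p x‖ ≤ lineConst k * t * M := by
  have hx : p x = ∑ i ∈ Finset.range (k + 1),
      (lineBasis k i).eval 0 • p (x + ((i : ℝ) / k) • u) := by
    simpa using hp x u 0
  rw [hp x u t, hx, ← Finset.sum_sub_distrib]
  refine (norm_sum_le _ _).trans ?_
  rw [lineConst, Finset.sum_mul, Finset.sum_mul]
  refine Finset.sum_le_sum fun i hi => ?_
  rw [← sub_smul, norm_smul, Real.norm_eq_abs]
  have hik : (i : ℝ) / k ≤ 1 :=
    div_le_one_of_le₀ (by exact_mod_cast Nat.lt_succ_iff.1 (Finset.mem_range.1 hi)) (by positivity)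
  refine mul_le_mul ?_ (hM _ (by positivity) hik) (norm_nonneg _) (by positivity)
  rw [mul_comm]
  exact abs_eval_sub_eval_zero_le _ h0 h1

theorem IsLineInterp.fderiv_apply (hp : IsLineInterp k p) (hd : Differentiable ℝ p) (x u : E) :
    fderiv ℝ p x u = ∑ i ∈ Finset.range (k + 1),
      (lineBasis k i).derivative.eval 0 • p (x + ((i : ℝ) / k) • u) := by
  have h1 : HasDerivAt (fun t : ℝ => p (x + t • u)) (fderiv ℝ p x u) 0 := by
    have h := (hd x).hasFDerivAt
    have h' : HasFDerivAt p (fderiv ℝ p x) (x + (0 : ℝ) • u) := by simpa using h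
    have hl : HasDerivAt (fun t : ℝ => x + t • u) u 0 := by
      simpa using ((hasDerivAt_id (0 : ℝ)).smul_const u).const_add x
    exact h'.comp_hasDerivAt 0 hl
  have h2 : HasDerivAt (fun t : ℝ => p (x + t • u)) (∑ i ∈ Finset.range (k + 1),
      (lineBasis k i).derivative.eval 0 • p (x + ((i : ℝ) / k) • u)) 0 := by
    rw [funext (hp x u)]
    exact HasDerivAt.fun_sum fun i _ => ((lineBasis k i).hasDerivAt 0).smul_const _
  exact h1.unique h2

theorem IsLineInterp.norm_fderiv_apply_le (hp : IsLineInterp k p) (hd : Differentiable ℝ p)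
    {x u : E} {M : ℝ} (hM : ∀ s : ℝ, 0 ≤ s → s ≤ 1 → ‖p (x + s • u)‖ ≤ M) :
    ‖fderiv ℝ p x u‖ ≤ lineConst k * M := by
  rw [hp.fderiv_apply hd, lineConst, Finset.sum_mul]
  refine (norm_sum_le _ _).trans (Finset.sum_le_sum fun i hi => ?_)
  rw [norm_smul, Real.norm_eq_abs]
  have hik : (i : ℝ) / k ≤ 1 :=
    div_le_one_of_le₀ (by exact_mod_cast Nat.lt_succ_iff.1 (Finset.mem_range.1 hi)) (by positivity)
  exact mul_le_mul (abs_derivative_eval_zero_le _) (hM _ (by positivity) hik) (norm_nonneg _)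
    (Finset.sum_nonneg fun _ _ => abs_nonneg _)

theorem IsLineInterp.fderiv_apply_const (hp : IsLineInterp k p) (hd : Differentiable ℝ p) (u : E) :
    IsLineInterp k (fun x => fderiv ℝ p x u) := by
  intro x v t
  simp only [hp.fderiv_apply hd _ u, Finset.smul_sum]
  rw [Finset.sum_comm]
  refine Finset.sum_congr rfl fun i _ => ?_
  have e : ∀ s : ℝ, x + s • v + ((i : ℝ) / k) • u = (x + ((i : ℝ) / k) • u) + s • v := by
    intro s; abel
  simp only [e, hp _ v t, Finset.smul_sum]
  exact Finset.sum_congr rfl fun j _ => smul_comm _ _ _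

/-- Markov's inequality on a convex set `K` that contains a ball of radius `r`: each direction of
length `r` is the difference of two vectors that lead from a given point of `K` into `K`, and in
such directions the inequality is one-dimensional. -/
theorem IsLineInterp.norm_fderiv_le (hp : IsLineInterp k p) (hd : Differentiable ℝ p)
    {K : Set E} (hK : Convex ℝ K) {x₀ : E} {r : ℝ} (hr : 0 ≤ r)
    (hball : Metric.closedBall x₀ r ⊆ K) {M : ℝ} (hM : ∀ y ∈ K, ‖p y‖ ≤ M) {x : E} (hx : x ∈ K)
    {e : E} (he : ‖e‖ ≤ 1) : r * ‖fderiv ℝ p x e‖ ≤ 2 * lineConst k * M := by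
  have main : ∀ y ∈ K, ‖fderiv ℝ p x (y - x)‖ ≤ lineConst k * M := by
    intro y hy
    refine hp.norm_fderiv_apply_le hd fun s h0 h1 => hM _ ?_
    have := hK.add_smul_sub_mem hx hy ⟨h0, h1⟩
    exact this
  have h1 := main (x₀ + r • e) (hball (by
    rw [Metric.mem_closedBall, dist_eq_norm, add_sub_cancel_left, norm_smul, Real.norm_of_nonneg hr]
    exact mul_le_of_le_one_right hr he))
  have h2 := main x₀ (hball (Metric.mem_closedBall_self hr))
  have e1 : r • e = (x₀ + r • e - x) - (x₀ - x) := by abel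
  have e2 : r * ‖fderiv ℝ p x e‖ = ‖fderiv ℝ p x (r • e)‖ := by
    rw [map_smul, norm_smul, Real.norm_of_nonneg hr]
  rw [e2, e1, map_sub]
  refine (norm_sub_le _ _).trans ?_
  linarith

/-- The iterated form of Markov's inequality. -/
theorem IsLineInterp.norm_iteratedFDeriv_le {K : Set E} (hK : Convex ℝ K) {x₀ : E} {r : ℝ}
    (hr : 0 ≤ r) (hball : Metric.closedBall x₀ r ⊆ K) (m : ℕ) {p : E → F}
    (hp : IsLineInterp k p) (hd : ContDiff ℝ ⊤ p) {M : ℝ} (hM0 : 0 ≤ M)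
    (hM : ∀ y ∈ K, ‖p y‖ ≤ M) {x : E}
    (hx : x ∈ K) (e : Fin m → E) (he : ∀ i, ‖e i‖ ≤ 1) :
    r ^ m * ‖iteratedFDeriv ℝ m p x e‖ ≤ (2 * lineConst k) ^ m * M := by
  rcases hr.eq_or_lt with rfl | hr
  · rcases m with _ | m
    · simpa using hM x hx
    · rw [zero_pow (Nat.succ_ne_zero m), zero_mul]
      have := lineConst_nonneg k
      positivity
  induction m generalizing p M with
  | zero => simpa using hM x hx
  | succ m ih =>
    have hdiff : Differentiable ℝ p := hd.differentiable (by simp)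
    have hd' : ContDiff ℝ ⊤ (fun y => fderiv ℝ p y) := hd.fderiv_right (by simp)
    have hC := lineConst_nonneg k
    have hd'' : ContDiff ℝ ⊤ (fun y => fderiv ℝ p y (e (Fin.last m))) :=
      hd'.clm_apply contDiff_const
    have key : iteratedFDeriv ℝ (m + 1) p x e =
        iteratedFDeriv ℝ m (fun y => fderiv ℝ p y (e (Fin.last m))) x (Fin.init e) := by
      rw [iteratedFDeriv_succ_apply_right]
      have := (ContinuousLinearMap.apply ℝ F (e (Fin.last m))).iteratedFDeriv_comp_left
        (f := fun y => fderiv ℝ p y) (x := x) (i := m) (n := m) (hd'.of_le (by simp)).contDiffAt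
        le_rfl
      change _ = (iteratedFDeriv ℝ m ((ContinuousLinearMap.apply ℝ F (e (Fin.last m))) ∘
        fun y => fderiv ℝ p y) x) _
      rw [this]
      rfl
    have hb : ∀ y ∈ K, ‖fderiv ℝ p y (e (Fin.last m))‖ ≤ 2 * lineConst k * M / r := by
      intro y hy
      rw [le_div_iff₀ hr, mul_comm]
      exact hp.norm_fderiv_le hdiff hK hr.le hball hM hy (he _)
    have := ih (hp.fderiv_apply_const hdiff (e (Fin.last m))) hd'' (by positivity) hb (Fin.init e)
      (fun i => he _)
    rw [key, pow_succ, mul_right_comm]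
    calc _ ≤ (2 * lineConst k) ^ m * (2 * lineConst k * M / r) * r :=
          mul_le_mul_of_nonneg_right this hr.le
      _ = _ := by rw [pow_succ]; field_simp

end

/-! ### Unisolvence of the Lagrange nodes of a simplex -/

section

variable {σ : Type*} [Fintype σ]

/-- A polynomial of degree at most `k` is a homogeneous polynomial of degree `k` in barycentric
coordinates: the monomials of lower degree are multiplied by powers of the sum of all
coordinates. -/
theorem IsPoly.exists_isHomogeneous {d k : ℕ} {p : Eu d → ℝ} (hp : IsPoly k p) (y : σ → Eu d) :
    ∃ Q : MvPolynomial σ ℝ, Q.IsHomogeneous k ∧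
      ∀ w : σ → ℝ, ∑ i, w i = 1 → p (∑ i, w i • y i) = MvPolynomial.eval w Q := by
  obtain ⟨q, hq, hpq⟩ := hp
  have hlin : ∀ a : σ → ℝ,
      (∑ i, MvPolynomial.C (a i) * MvPolynomial.X i : MvPolynomial σ ℝ).IsHomogeneous 1 :=
    fun a => MvPolynomial.IsHomogeneous.sum _ _ _ fun i _ => by
      simpa using (MvPolynomial.isHomogeneous_C σ (a i)).mul (MvPolynomial.isHomogeneous_X ℝ i)
  refine ⟨∑ m ∈ q.support, MvPolynomial.C (q.coeff m) *
    (∏ j, (∑ i, MvPolynomial.C (y i j) * MvPolynomial.X i) ^ m j) *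
    (∑ i, MvPolynomial.C (1 : ℝ) * MvPolynomial.X i) ^ (k - ∑ j, m j), ?_, fun w hw => ?_⟩
  · refine MvPolynomial.IsHomogeneous.sum _ _ _ fun m hm => ?_
    have hmk : ∑ j, m j ≤ k := by
      have := (MvPolynomial.le_totalDegree hm).trans hq
      rwa [Finsupp.sum_fintype _ _ (fun _ => rfl)] at this
    have h1 : (∏ j, (∑ i, MvPolynomial.C (y i j) * MvPolynomial.X i :
        MvPolynomial σ ℝ) ^ m j).IsHomogeneous (∑ j, m j) :=
      MvPolynomial.IsHomogeneous.prod _ _ _ fun j _ => by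
        simpa using (hlin fun i => y i j).pow (m j)
    have h2 := (hlin fun _ => 1).pow (k - ∑ j, m j)
    have h3 := ((MvPolynomial.isHomogeneous_C σ (q.coeff m)).mul h1).mul h2
    convert h3 using 1
    omega
  · rw [hpq, MvPolynomial.eval_eq']
    simp only [map_sum, map_mul, map_prod, map_pow, MvPolynomial.eval_C, MvPolynomial.eval_X,
      one_mul, hw, one_pow, mul_one]
    refine Finset.sum_congr rfl fun m _ => ?_
    congr 1
    refine Finset.prod_congr rfl fun j _ => ?_
    congr 1
    simp [mul_comm]

/-- The Lagrange basis function of order `k` on a simplex, as a homogeneous polynomial in the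
barycentric coordinates. It belongs to the node with barycentric coordinates `α / k`. -/
def lagrangeHom (k : ℕ) (α : σ → ℕ) : MvPolynomial σ ℝ :=
  ∏ i, ∏ j ∈ Finset.range (α i), MvPolynomial.C (((j : ℝ) + 1)⁻¹) *
    (MvPolynomial.C (k : ℝ) * MvPolynomial.X i -
      MvPolynomial.C (j : ℝ) * ∑ i', MvPolynomial.X i')

theorem lagrangeHom_isHomogeneous {k : ℕ} (α : σ → ℕ) :
    (lagrangeHom k α).IsHomogeneous (∑ i, α i) := by
  refine MvPolynomial.IsHomogeneous.prod _ _ _ fun i _ => ?_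
  have h : ∀ j ∈ Finset.range (α i), (MvPolynomial.C (((j : ℝ) + 1)⁻¹) *
    (MvPolynomial.C (k : ℝ) * MvPolynomial.X i -
      MvPolynomial.C (j : ℝ) * ∑ i', MvPolynomial.X i') : MvPolynomial σ ℝ).IsHomogeneous 1 := by
    intro j _
    have h1 := (MvPolynomial.isHomogeneous_C σ (k : ℝ)).mul (MvPolynomial.isHomogeneous_X ℝ i)
    have h2 := (MvPolynomial.isHomogeneous_C σ (j : ℝ)).mul
      (MvPolynomial.IsHomogeneous.sum Finset.univ (fun i' : σ => (MvPolynomial.X i' :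
        MvPolynomial σ ℝ)) 1 fun i' _ => MvPolynomial.isHomogeneous_X ℝ i')
    simpa using (MvPolynomial.isHomogeneous_C σ (((j : ℝ) + 1)⁻¹)).mul (h1.sub h2)
  simpa using MvPolynomial.IsHomogeneous.prod _ _ _ h

theorem eval_lagrangeHom {k : ℕ} (α : σ → ℕ) {w : σ → ℝ} (hw : ∑ i, w i = 1) :
    MvPolynomial.eval w (lagrangeHom k α) =
      ∏ i, ∏ j ∈ Finset.range (α i), ((k : ℝ) * w i - j) / (j + 1) := by
  simp only [lagrangeHom, map_prod, map_mul, map_sub, map_sum, MvPolynomial.eval_C,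
    MvPolynomial.eval_X, hw, mul_one, div_eq_inv_mul]

theorem eval_lagrangeHom_node {k : ℕ} (hk : 1 ≤ k) {α β : σ → ℕ} (hα : ∑ i, α i = k)
    (hβ : ∑ i, β i = k) :
    MvPolynomial.eval (fun i => (β i : ℝ) / k) (lagrangeHom k α) = if α = β then 1 else 0 := by
  have hk0 : (k : ℝ) ≠ 0 := by positivity
  rw [eval_lagrangeHom _ (by rw [← Finset.sum_div, ← Nat.cast_sum, hβ, div_self hk0])]
  simp only [mul_div_cancel₀ _ hk0]
  split_ifs with h
  · subst h
    refine Finset.prod_eq_one fun i _ => ?_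
    rw [Finset.prod_div_distrib, div_eq_one_iff_eq
      (Finset.prod_ne_zero_iff.2 fun j _ => by positivity), ← Finset.prod_range_reflect]
    refine Finset.prod_congr rfl fun j hj => ?_
    rw [Finset.mem_range] at hj
    rw [show α i - 1 - j = α i - (j + 1) by omega, Nat.cast_sub (by omega)]
    push_cast
    ring
  · obtain ⟨i, hi⟩ : ∃ i, β i < α i := by
      by_contra! hle
      exact h (funext fun i => (Finset.sum_eq_sum_iff_of_le fun i _ => hle i).1
        (hα.trans hβ.symm) i (Finset.mem_univ i))
    refine Finset.prod_eq_zero (Finset.mem_univ i)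
      (Finset.prod_eq_zero (Finset.mem_range.2 hi) ?_)
    simp

theorem abs_eval_lagrangeHom_le {k : ℕ} {α : σ → ℕ} (hα : ∑ i, α i = k) {w : σ → ℝ}
    (hw : ∑ i, w i = 1) (hw0 : ∀ i, 0 ≤ w i) :
    |MvPolynomial.eval w (lagrangeHom k α)| ≤ (k : ℝ) ^ k := by
  rw [eval_lagrangeHom _ hw, Finset.abs_prod]
  simp only [Finset.abs_prod]
  calc _ ≤ ∏ i, ∏ j ∈ Finset.range (α i), (k : ℝ) := by
        refine Finset.prod_le_prod (fun i _ => Finset.prod_nonneg fun j _ => abs_nonneg _)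
          fun i _ => Finset.prod_le_prod (fun j _ => abs_nonneg _) fun j hj => ?_
        have hjk : j ≤ k := (Finset.mem_range.1 hj).le.trans
          (hα ▸ Finset.single_le_sum (fun _ _ => Nat.zero_le _) (Finset.mem_univ i))
        have hjk' : (j : ℝ) ≤ k := by exact_mod_cast hjk
        have hw1 : w i ≤ 1 := hw ▸ Finset.single_le_sum (fun i _ => hw0 i) (Finset.mem_univ i)
        have h1 : (k : ℝ) * w i ≤ k := mul_le_of_le_one_right (by positivity) hw1
        have h2 : 0 ≤ (k : ℝ) * w i := mul_nonneg (by positivity) (hw0 i)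
        rw [abs_div, abs_of_pos (by positivity : (0 : ℝ) < (j : ℝ) + 1)]
        refine (div_le_self (abs_nonneg _) (by linarith [(Nat.cast_nonneg j : (0 : ℝ) ≤ j)])).trans ?_
        rw [abs_le]
        constructor <;> linarith [(Nat.cast_nonneg j : (0 : ℝ) ≤ j)]
    _ = (k : ℝ) ^ k := by
        simp only [Finset.prod_const, Finset.card_range]
        rw [Finset.prod_pow_eq_pow_sum, hα]

theorem eval_eq_sum_piAntidiag [DecidableEq σ] {k : ℕ} {Q : MvPolynomial σ ℝ} (hQ : Q.IsHomogeneous k)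
    (w : σ → ℝ) : MvPolynomial.eval w Q =
      ∑ α ∈ (Finset.univ : Finset σ).piAntidiag k,
        Q.coeff (Finsupp.equivFunOnFinite.symm α) * ∏ i, w i ^ α i := by
  rw [MvPolynomial.eval_eq']
  have h : Q.support ⊆ ((Finset.univ : Finset σ).piAntidiag k).map
      Finsupp.equivFunOnFinite.symm.toEmbedding := by
    intro m hm
    rw [Finset.mem_map]
    refine ⟨⇑m, ?_, by ext; simp⟩
    rw [Finset.mem_piAntidiag]
    refine ⟨?_, fun _ _ => Finset.mem_univ _⟩
    rw [← hQ (MvPolynomial.mem_support_iff.1 hm), ← Finsupp.degree_eq_sum,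
      Finsupp.degree_eq_weight_one (R := ℕ)]
    rfl
  rw [Finset.sum_subset h, Finset.sum_map]
  · rfl
  · intro m _ hm
    rw [MvPolynomial.notMem_support_iff.1 hm, zero_mul]

/-- The Lagrange nodes determine a homogeneous polynomial of degree `k`: in terms of coefficients,
evaluation at the nodes is a square linear system, which the Lagrange basis functions show to be
always solvable. -/
theorem eq_zero_of_eval_nodes [DecidableEq σ] {k : ℕ} (hk : 1 ≤ k) {Q : MvPolynomial σ ℝ}
    (hQ : Q.IsHomogeneous k)
    (h : ∀ β : σ → ℕ, ∑ i, β i = k → MvPolynomial.eval (fun i => (β i : ℝ) / k) Q = 0) :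
    ∀ w, MvPolynomial.eval w Q = 0 := by
  let X : Finset (σ → ℕ) := (Finset.univ : Finset σ).piAntidiag k
  have hX : ∀ α : X, ∑ i, α.1 i = k := fun α => (Finset.mem_piAntidiag.1 α.2).1
  let Φ : (X → ℝ) →ₗ[ℝ] (X → ℝ) :=
    { toFun := fun c β => ∑ α, c α * ∏ i, ((β.1 i : ℝ) / k) ^ α.1 i
      map_add' := fun c c' => by
        funext β; simp only [Pi.add_apply, add_mul, Finset.sum_add_distrib]
      map_smul' := fun r c => by
        funext β
        simp only [Pi.smul_apply, smul_eq_mul, RingHom.id_apply, mul_assoc, Finset.mul_sum] }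
  let coef : MvPolynomial σ ℝ → X → ℝ := fun P α => P.coeff (Finsupp.equivFunOnFinite.symm α.1)
  have key : ∀ P : MvPolynomial σ ℝ, P.IsHomogeneous k → ∀ β : X,
      Φ (coef P) β = MvPolynomial.eval (fun i => (β.1 i : ℝ) / k) P := by
    intro P hP β
    rw [eval_eq_sum_piAntidiag hP, ← Finset.sum_coe_sort]
    rfl
  have hsurj : Function.Surjective Φ := by
    intro r
    let P : MvPolynomial σ ℝ := ∑ α : X, MvPolynomial.C (r α) * lagrangeHom k α.1
    have hP : P.IsHomogeneous k := MvPolynomial.IsHomogeneous.sum _ _ _ fun α _ => by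
      simpa [hX α] using (MvPolynomial.isHomogeneous_C σ (r α)).mul
        (lagrangeHom_isHomogeneous (k := k) α.1)
    refine ⟨coef P, funext fun β => ?_⟩
    rw [key P hP]
    simp only [P, map_sum, map_mul, MvPolynomial.eval_C, eval_lagrangeHom_node hk (hX _) (hX β)]
    rw [Finset.sum_eq_single β]
    · simp
    · intro α _ hne
      rw [if_neg fun h => hne (Subtype.ext h), mul_zero]
    · simp
  have hinj : Function.Injective Φ := LinearMap.injective_iff_surjective.2 hsurj
  have h0 : coef Q = 0 := hinj (by
    rw [map_zero]
    funext β
    rw [key Q hQ, h _ (hX β)]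
    rfl)
  intro w
  rw [eval_eq_sum_piAntidiag hQ]
  refine Finset.sum_eq_zero fun α hα => ?_
  have : coef Q ⟨α, hα⟩ = 0 := by rw [h0]; rfl
  rw [show Q.coeff (Finsupp.equivFunOnFinite.symm α) = 0 from this, zero_mul]

theorem eval_eq_sum_lagrangeHom [DecidableEq σ] {k : ℕ} (hk : 1 ≤ k) {Q : MvPolynomial σ ℝ}
    (hQ : Q.IsHomogeneous k) (w : σ → ℝ) : MvPolynomial.eval w Q =
      ∑ α ∈ (Finset.univ : Finset σ).piAntidiag k, MvPolynomial.eval w (lagrangeHom k α) *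
        MvPolynomial.eval (fun i => (α i : ℝ) / k) Q := by
  let P : MvPolynomial σ ℝ := ∑ α ∈ (Finset.univ : Finset σ).piAntidiag k,
    MvPolynomial.C (MvPolynomial.eval (fun i => (α i : ℝ) / k) Q) * lagrangeHom k α
  have hX : ∀ α ∈ (Finset.univ : Finset σ).piAntidiag k, ∑ i, α i = k :=
    fun α hα => (Finset.mem_piAntidiag.1 hα).1
  have hP : P.IsHomogeneous k := MvPolynomial.IsHomogeneous.sum _ _ _ fun α hα => by
    simpa [hX α hα] using (MvPolynomial.isHomogeneous_C σ _).mul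
      (lagrangeHom_isHomogeneous (k := k) α)
  have h := eq_zero_of_eval_nodes hk (hQ.sub hP) (fun β hβ => by
    have hβ' : β ∈ (Finset.univ : Finset σ).piAntidiag k :=
      Finset.mem_piAntidiag.2 ⟨hβ, fun _ _ => Finset.mem_univ _⟩
    rw [map_sub, sub_eq_zero]
    simp only [P, map_sum, map_mul, MvPolynomial.eval_C]
    rw [Finset.sum_eq_single β]
    · rw [eval_lagrangeHom_node hk hβ hβ, if_pos rfl, mul_one]
    · intro α hα hne
      rw [eval_lagrangeHom_node hk (hX α hα) hβ, if_neg hne, mul_zero]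
    · exact fun h => absurd hβ' h) w
  rw [map_sub, sub_eq_zero] at h
  rw [h]
  simp only [P, map_sum, map_mul, MvPolynomial.eval_C]
  exact Finset.sum_congr rfl fun α _ => mul_comm _ _

end

/-- Stability of Lagrange interpolation: on a simplex, a polynomial is bounded by its values at the
Lagrange nodes. -/
theorem IsPolyVec.norm_le_of_nodes {d l k : ℕ} (hk : 1 ≤ k) {p : Eu d → Eu l}
    (hp : IsPolyVec k p) (T : Finset (Eu d)) {R : ℝ}
    (hR : ∀ α ∈ T.piAntidiag k, ‖p (∑ y ∈ T, ((α y : ℝ) / (k : ℝ)) • y)‖ ≤ R)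
    {x : Eu d} (hx : x ∈ simplex T) :
    ‖p x‖ ≤ ((k : ℝ) + 1) ^ T.card * (k : ℝ) ^ k * R := by
  have hk0 : (k : ℝ) ≠ 0 := by positivity
  obtain ⟨w, hw0, hw1, rfl⟩ := Finset.mem_convexHull'.1 hx
  set X := (Finset.univ : Finset T).piAntidiag k
  have hX : ∀ α ∈ X, ∑ i, α i = k := fun α hα => (Finset.mem_piAntidiag.1 hα).1
  have hw1' : ∑ i : T, w i = 1 := by rw [Finset.sum_coe_sort T w, hw1]
  have id1 : p (∑ y ∈ T, w y • y) = ∑ α ∈ X,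
      MvPolynomial.eval (fun i : T => w i) (lagrangeHom k α) •
        p (∑ i : T, ((α i : ℝ) / k) • (i : Eu d)) := by
    ext j
    obtain ⟨Q, hQ, hpQ⟩ := (hp j).exists_isHomogeneous (fun i : T => (i : Eu d))
    have e1 := hpQ (fun i => w i) hw1'
    rw [Finset.sum_coe_sort T (fun y => w y • y)] at e1
    rw [e1, eval_eq_sum_lagrangeHom hk hQ]
    simp only [WithLp.ofLp_sum, Finset.sum_apply, WithLp.ofLp_smul, Pi.smul_apply, smul_eq_mul]
    refine Finset.sum_congr rfl fun α hα => ?_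
    rw [hpQ (fun i => (α i : ℝ) / k)
      (by rw [← Finset.sum_div, ← Nat.cast_sum, hX α hα, div_self hk0])]
  have hnode : ∀ α ∈ X, ‖p (∑ i : T, ((α i : ℝ) / k) • (i : Eu d))‖ ≤ R := by
    intro α hα
    let α' : Eu d → ℕ := fun y => if h : y ∈ T then α ⟨y, h⟩ else 0
    have hα' : ∀ i : T, α' i = α i := fun i => by simp [α']
    have e : ∑ i : T, ((α i : ℝ) / k) • (i : Eu d) = ∑ y ∈ T, ((α' y : ℝ) / k) • y := by
      rw [← Finset.sum_coe_sort T]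
      simp only [hα']
    rw [e]
    refine hR α' (Finset.mem_piAntidiag.2 ⟨?_, fun y hy => ?_⟩)
    · rw [← Finset.sum_coe_sort T α', ← hX α hα]
      exact Finset.sum_congr rfl fun i _ => hα' i
    · by_contra h
      simp [α', h] at hy
  have hcard : (X.card : ℝ) ≤ ((k : ℝ) + 1) ^ T.card := by
    have h : X ⊆ Fintype.piFinset fun _ : T => Finset.range (k + 1) := by
      intro α hα
      rw [Fintype.mem_piFinset]
      intro i
      rw [Finset.mem_range, Nat.lt_succ_iff, ← hX α hα]
      exact Finset.single_le_sum (fun _ _ => Nat.zero_le _) (Finset.mem_univ i)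
    have := Finset.card_le_card h
    rw [Fintype.card_piFinset] at this
    simp only [Finset.card_range, Finset.prod_const, Finset.card_univ, Fintype.card_coe] at this
    exact_mod_cast this
  rw [id1]
  rcases X.eq_empty_or_nonempty with hX0 | ⟨α₀, hα₀⟩
  · obtain ⟨i⟩ : Nonempty T := by
      by_contra hne
      rw [not_nonempty_iff] at hne
      simp at hw1'
    exfalso
    have : Pi.single i k ∈ X := Finset.mem_piAntidiag.2 ⟨by simp, fun _ _ => Finset.mem_univ _⟩
    rw [hX0] at this
    simp at this
  have hR0 : 0 ≤ R := (norm_nonneg _).trans (hnode α₀ hα₀)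
  calc _ ≤ ∑ α ∈ X, (k : ℝ) ^ k * R := by
        refine (norm_sum_le _ _).trans (Finset.sum_le_sum fun α hα => ?_)
        rw [norm_smul, Real.norm_eq_abs]
        exact mul_le_mul (abs_eval_lagrangeHom_le (hX α hα) hw1' fun i => hw0 i i.2)
          (hnode α hα) (norm_nonneg _) (by positivity)
    _ = X.card * ((k : ℝ) ^ k * R) := by rw [Finset.sum_const, nsmul_eq_mul]
    _ ≤ _ := by
        rw [mul_assoc]
        exact mul_le_mul_of_nonneg_right hcard (by positivity)

/-! ### Nondegenerate simplices -/

theorem isCompact_simplex {d : ℕ} (s : Finset (Eu d)) : IsCompact (simplex s) :=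
  s.finite_toSet.isCompact_convexHull ℝ

theorem isClosed_simplex {d : ℕ} (s : Finset (Eu d)) : IsClosed (simplex s) :=
  (isCompact_simplex s).isClosed

theorem convex_simplex {d : ℕ} (s : Finset (Eu d)) : Convex ℝ (simplex s) :=
  convex_convexHull ℝ _

theorem simplex_mono {d : ℕ} {s t : Finset (Eu d)} (h : s ⊆ t) : simplex s ⊆ simplex t :=
  convexHull_mono (by exact_mod_cast h)

theorem affineSpan_ne_top_of_card_le {d : ℕ} {s : Finset (Eu d)} (hs : s.card ≤ d) :
    affineSpan ℝ (s : Set (Eu d)) ≠ ⊤ := by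
  intro h
  rcases s.eq_empty_or_nonempty with rfl | hne
  · simp at h
  · have : Nonempty s := hne.to_subtype
    have h1 := finrank_vectorSpan_range_add_one_le ℝ ((↑) : s → Eu d)
    rw [← direction_affineSpan, Subtype.range_coe_subtype] at h1
    have h2 : affineSpan ℝ {x | x ∈ s} = ⊤ := h
    rw [h2, AffineSubspace.direction_top, finrank_top, finrank_euclideanSpace, Fintype.card_fin,
      Fintype.card_coe] at h1
    omega

theorem volume_affineSpan_eq_zero {d : ℕ} {s : Finset (Eu d)} (hs : s.card ≤ d) :
    volume (affineSpan ℝ (s : Set (Eu d)) : Set (Eu d)) = 0 :=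
  Measure.addHaar_affineSubspace _ _ (affineSpan_ne_top_of_card_le hs)

theorem simplex_subset_affineSpan {d : ℕ} (s : Finset (Eu d)) :
    simplex s ⊆ (affineSpan ℝ (s : Set (Eu d)) : Set (Eu d)) :=
  convexHull_subset_affineSpan _

theorem volume_simplex_eq_zero {d : ℕ} {s : Finset (Eu d)} (hs : s.card ≤ d) :
    volume (simplex s) = 0 :=
  measure_mono_null (simplex_subset_affineSpan s) (volume_affineSpan_eq_zero hs)

/-- `A y` is the barycentric coordinate that belongs to the vertex `y` of a nondegenerate
`d`-simplex, as an affine function on the whole space. -/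
structure IsCoords {d : ℕ} (s : Finset (Eu d)) (A : Eu d → Eu d →ᵃ[ℝ] ℝ) : Prop where
  apply_self : ∀ y ∈ s, A y y = 1
  apply_ne : ∀ y ∈ s, ∀ y' ∈ s, y ≠ y' → A y y' = 0
  mem_iff : ∀ x, x ∈ simplex s ↔ ∀ y ∈ s, 0 ≤ A y x
  sum_eq : ∀ x, ∑ y ∈ s, A y x = 1
  sum_smul : ∀ x, ∑ y ∈ s, A y x • y = x

theorem exists_isCoords {d : ℕ} {s : Finset (Eu d)} (hs : AffineIndependent ℝ ((↑) : s → Eu d))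
    (hcard : s.card = d + 1) :
    ∃ A : Eu d → Eu d →ᵃ[ℝ] ℝ, IsCoords s A := by
  have htop : affineSpan ℝ (range ((↑) : s → Eu d)) = ⊤ :=
    hs.affineSpan_eq_top_iff_card_eq_finrank_add_one.2 (by simp [hcard])
  let b : AffineBasis s ℝ (Eu d) := ⟨(↑), hs, htop⟩
  have hb : ∀ i : s, b i = i := fun _ => rfl
  have hrange : range b = (s : Set (Eu d)) := Subtype.range_coe
  let A : Eu d → Eu d →ᵃ[ℝ] ℝ := fun y => if h : y ∈ s then b.coord ⟨y, h⟩ else 0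
  have hA : ∀ i : s, A i = b.coord i := fun i => by simp [A]
  refine ⟨A, ⟨fun y hy => ?_, fun y hy y' hy' hne => ?_, fun x => ?_, fun x => ?_, fun x => ?_⟩⟩
  · have := b.coord_apply_eq ⟨y, hy⟩
    rwa [← hA] at this
  · have := b.coord_apply_ne (i := ⟨y, hy⟩) (j := ⟨y', hy'⟩) (by simpa using hne)
    rwa [← hA] at this
  · rw [simplex, ← hrange, b.convexHull_eq_nonneg_coord]
    simp only [Set.mem_ofPred_eq, ← hA]
    exact ⟨fun h y hy => h ⟨y, hy⟩, fun h i => h i i.2⟩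
  · rw [← Finset.sum_coe_sort s (fun y => A y x)]
    simp only [hA]
    exact b.sum_coord_apply_eq_one x
  · rw [← Finset.sum_coe_sort s (fun y => A y x • y)]
    simp only [hA]
    exact b.linear_combination_coord_eq_self x

theorem IsCoords.apply_eq_sum {d : ℕ} {s : Finset (Eu d)} {A : Eu d → Eu d →ᵃ[ℝ] ℝ}
    (h : IsCoords s A) (B : Eu d →ᵃ[ℝ] ℝ) (x : Eu d) : B x = ∑ y ∈ s, A y x * B y := by
  have e : s.affineCombination ℝ id (fun y => A y x) = x := by
    rw [Finset.affineCombination_eq_linear_combination s id _ (h.sum_eq x)]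
    exact h.sum_smul x
  conv_lhs => rw [← e]
  rw [Finset.map_affineCombination s id _ (h.sum_eq x) B,
    Finset.affineCombination_eq_linear_combination _ _ _ (h.sum_eq x)]
  simp

theorem affineMap_sum_apply {d : ℕ} (B : Eu d →ᵃ[ℝ] ℝ) (s : Finset (Eu d)) {w : Eu d → ℝ}
    (hw : ∑ y ∈ s, w y = 1) : B (∑ y ∈ s, w y • y) = ∑ y ∈ s, w y * B y := by
  have e : s.affineCombination ℝ id w = ∑ y ∈ s, w y • y := by
    rw [Finset.affineCombination_eq_linear_combination s id _ hw]
    rfl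
  rw [← e, Finset.map_affineCombination s id _ hw B,
    Finset.affineCombination_eq_linear_combination _ _ _ hw]
  simp

theorem interior_simplex_nonempty {d : ℕ} {s : Finset (Eu d)}
    (hs : AffineIndependent ℝ ((↑) : s → Eu d)) (hcard : s.card = d + 1) :
    (interior (simplex s)).Nonempty := by
  rw [simplex, interior_convexHull_nonempty_iff_affineSpan_eq_top]
  have := hs.affineSpan_eq_top_iff_card_eq_finrank_add_one.2 (by simp [hcard])
  simpa using this

/-- The barycenter of a simplex. -/
def barycenter {d : ℕ} (s : Finset (Eu d)) : Eu d := ∑ y ∈ s, ((s.card : ℝ)⁻¹) • y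

theorem sum_inv_card {d : ℕ} {s : Finset (Eu d)} (hs : s.Nonempty) :
    ∑ _y ∈ s, ((s.card : ℝ)⁻¹) = 1 := by
  have : (s.card : ℝ) ≠ 0 := by exact_mod_cast hs.card_ne_zero
  rw [Finset.sum_const, nsmul_eq_mul, mul_inv_cancel₀ this]

theorem barycenter_mem {d : ℕ} {s : Finset (Eu d)} (hs : s.Nonempty) : barycenter s ∈ simplex s :=
  Finset.mem_convexHull'.2 ⟨fun _ => (s.card : ℝ)⁻¹, fun _ _ => by positivity, sum_inv_card hs, rfl⟩

/-- The barycenter of a nondegenerate simplex lies on no proper face. -/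
theorem subset_of_barycenter_mem {d : ℕ} {s t : Finset (Eu d)}
    (hs : AffineIndependent ℝ ((↑) : s → Eu d)) (hne : s.Nonempty) (hts : t ⊆ s)
    (h : barycenter s ∈ simplex t) : s ⊆ t := by
  obtain ⟨u, -, hu1, hu2⟩ := Finset.mem_convexHull'.1 h
  intro y hy
  by_contra hyt
  have key := Triangulation.weights_unique hs (w := fun _ => (s.card : ℝ)⁻¹)
    (w' := fun y => if y ∈ t then u y else 0)
    (by
      rw [sum_inv_card hne, ← hu1, ← Finset.sum_subset hts]
      · exact Finset.sum_congr rfl fun y hy => (if_pos hy).symm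
      · intro y _ hy; exact if_neg hy)
    (by
      change barycenter s = _
      rw [← hu2, ← Finset.sum_subset hts]
      · exact Finset.sum_congr rfl fun y hy => by rw [if_pos hy]
      · intro y _ hy; rw [if_neg hy, zero_smul]) y hy
  simp only [if_neg hyt] at key
  have : (s.card : ℝ) ≠ 0 := by exact_mod_cast hne.card_ne_zero
  exact inv_ne_zero this key

/-! ### Elements and sides of a triangulation -/

namespace Triangulation

variable {d : ℕ} {Ω : Set (Eu d)} (𝒯 : Triangulation Ω)

theorem mem_sides {S : Finset (Eu d)} : S ∈ 𝒯.sides ↔ S ∈ 𝒯.complex.faces ∧ S.card = d := by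
  simp [sides]

theorem mem_elementsAt {z : Eu d} {T : Finset (Eu d)} :
    T ∈ 𝒯.elementsAt z ↔ T ∈ 𝒯.elements ∧ z ∈ simplex T := by
  simp [elementsAt]

theorem simplex_inter {s t : Finset (Eu d)} (hs : s ∈ 𝒯.complex.faces)
    (ht : t ∈ 𝒯.complex.faces) : simplex s ∩ simplex t = simplex (s ∩ t) := by
  rw [simplex, simplex, simplex, Finset.coe_inter]
  exact 𝒯.complex.convexHull_inter_convexHull hs ht

variable {T T' : Finset (Eu d)}

theorem interior_nonempty (hT : T ∈ 𝒯.elements) : (interior (simplex T)).Nonempty :=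
  interior_simplex_nonempty (𝒯.complex.indep (𝒯.mem_elements.1 hT).1) (𝒯.mem_elements.1 hT).2

theorem closure_interior (hT : T ∈ 𝒯.elements) : closure (interior (simplex T)) = simplex T := by
  rw [(convex_simplex T).closure_interior_eq_closure_of_nonempty_interior (𝒯.interior_nonempty hT),
    (isClosed_simplex T).closure_eq]

theorem card_inter_le (hT : T ∈ 𝒯.elements) (hT' : T' ∈ 𝒯.elements) (hne : T ≠ T') :
    (T ∩ T').card ≤ d := by
  by_contra! h
  have h1 := (𝒯.mem_elements.1 hT).2
  have h2 := (𝒯.mem_elements.1 hT').2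
  have e1 : T ∩ T' = T := Finset.eq_of_subset_of_card_le Finset.inter_subset_left (by omega)
  have e2 : T ∩ T' = T' := Finset.eq_of_subset_of_card_le Finset.inter_subset_right (by omega)
  exact hne (e1.symm.trans e2)

theorem disjoint_interior_simplex (hT : T ∈ 𝒯.elements) (hT' : T' ∈ 𝒯.elements) (hne : T ≠ T') :
    Disjoint (interior (simplex T)) (simplex T') := by
  rw [← 𝒯.closure_interior hT']
  refine Disjoint.closure_right ?_ isOpen_interior
  rw [Set.disjoint_iff_inter_eq_empty]
  refine (isOpen_interior.inter isOpen_interior).eq_empty_of_measure_zero (μ := volume)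
    (measure_mono_null ?_ (volume_simplex_eq_zero (𝒯.card_inter_le hT hT' hne)))
  rw [← 𝒯.simplex_inter (𝒯.mem_elements.1 hT).1 (𝒯.mem_elements.1 hT').1]
  exact inter_subset_inter interior_subset interior_subset

theorem isClosed_biUnion_simplex (F : Finset (Finset (Eu d))) :
    IsClosed (⋃ T ∈ F, simplex T) :=
  F.finite_toSet.isClosed_biUnion fun _ _ => isClosed_simplex _

theorem card_le_of_mem_faces {s : Finset (Eu d)} (hs : s ∈ 𝒯.complex.faces) : s.card ≤ d + 1 := by
  have : Nonempty s := (𝒯.complex.nonempty_of_mem_faces hs).to_subtype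
  have h := (𝒯.complex.indep hs).card_le_finrank_succ
  rw [Fintype.card_coe] at h
  have h2 := Submodule.finrank_le (vectorSpan ℝ (range ((↑) : s → Eu d)))
  rw [finrank_euclideanSpace, Fintype.card_fin] at h2
  omega

theorem simplex_subset_closure {s : Finset (Eu d)} (hs : s ∈ 𝒯.complex.faces) :
    simplex s ⊆ closure Ω := by
  rw [← 𝒯.space_eq]
  exact Geometry.SimplicialComplex.convexHull_subset_space hs

/-- The elements cover the domain, as the faces of lower dimension are null sets. -/
theorem closure_subset_biUnion_elements (hΩ : IsOpen Ω) :
    closure Ω ⊆ ⋃ T ∈ 𝒯.elements, simplex T := by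
  refine closure_minimal (fun x hx => ?_) (isClosed_biUnion_simplex _)
  rw [← (isClosed_biUnion_simplex _).closure_eq, mem_closure_iff]
  intro V hV hxV
  let D : Set (Eu d) := ⋃ s ∈ 𝒯.finite_faces.toFinset.filter fun s => s.card ≤ d, simplex s
  have hD : volume D = 0 := by
    refine (measure_biUnion_null_iff (Finset.countable_toSet _)).2 fun s hs => ?_
    exact volume_simplex_eq_zero (Finset.mem_filter.1 hs).2
  obtain ⟨y, ⟨hyV, hyΩ⟩, hyD⟩ : ((V ∩ Ω) \ D).Nonempty := by
    rw [Set.nonempty_iff_ne_empty, Ne, Set.sdiff_eq_empty]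
    intro h
    exact (hV.inter hΩ).measure_ne_zero volume ⟨x, hxV, hx⟩ (measure_mono_null h hD)
  refine ⟨y, hyV, ?_⟩
  have hy := subset_closure hyΩ
  rw [← 𝒯.space_eq, Geometry.SimplicialComplex.mem_space_iff] at hy
  obtain ⟨s, hs, hys⟩ := hy
  refine mem_biUnion (𝒯.mem_elements.2 ⟨hs, ?_⟩) hys
  have h1 := 𝒯.card_le_of_mem_faces hs
  by_contra hne
  refine hyD (mem_biUnion (Finset.mem_filter.2 ⟨𝒯.finite_faces.mem_toFinset.2 hs, ?_⟩) hys)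
  omega

theorem exists_mem_elements (hΩ : IsOpen Ω) {x : Eu d} (hx : x ∈ closure Ω) :
    ∃ T ∈ 𝒯.elements, x ∈ simplex T := by
  have := 𝒯.closure_subset_biUnion_elements hΩ hx
  simpa using this

/-- Each face lies in an element: the element that contains the barycenter of the face. -/
theorem exists_subset_element (hΩ : IsOpen Ω) {s : Finset (Eu d)} (hs : s ∈ 𝒯.complex.faces) :
    ∃ T ∈ 𝒯.elements, s ⊆ T := by
  have hne := 𝒯.complex.nonempty_of_mem_faces hs
  have hc := barycenter_mem hne
  obtain ⟨T, hT, hcT⟩ := 𝒯.exists_mem_elements hΩ (𝒯.simplex_subset_closure hs hc)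
  refine ⟨T, hT, ?_⟩
  have h : barycenter s ∈ simplex (s ∩ T) := by
    rw [← 𝒯.simplex_inter hs (𝒯.mem_elements.1 hT).1]
    exact ⟨hc, hcT⟩
  exact (subset_of_barycenter_mem (𝒯.complex.indep hs) hne Finset.inter_subset_left h).trans
    Finset.inter_subset_right

theorem inter_mem_sides (hd : 1 ≤ d) (hT : T ∈ 𝒯.elements) (hcard : (T ∩ T').card = d) :
    T ∩ T' ∈ 𝒯.sides :=
  𝒯.mem_sides.2 ⟨𝒯.complex.down_closed (𝒯.mem_elements.1 hT).1 Finset.inter_subset_left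
    (Finset.card_pos.1 (by omega)), hcard⟩

/-- Two elements with a common side lie on different sides of it, so that together they are a
neighborhood of its barycenter. -/
theorem barycenter_mem_interior_union (hd : 1 ≤ d) (hT : T ∈ 𝒯.elements) (hT' : T' ∈ 𝒯.elements)
    (hcard : (T ∩ T').card = d) :
    barycenter (T ∩ T') ∈ interior (simplex T ∪ simplex T') := by
  obtain ⟨hTf, hTc⟩ := 𝒯.mem_elements.1 hT
  obtain ⟨hTf', hTc'⟩ := 𝒯.mem_elements.1 hT'
  set S := T ∩ T' with hS
  have hSne : S.Nonempty := Finset.card_pos.1 (by omega)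
  obtain ⟨A, hA⟩ := exists_isCoords (𝒯.complex.indep hTf) hTc
  obtain ⟨B, hB⟩ := exists_isCoords (𝒯.complex.indep hTf') hTc'
  obtain ⟨a, ha⟩ : ∃ a, T \ S = {a} := by
    rw [← Finset.card_eq_one, Finset.card_sdiff_of_subset Finset.inter_subset_left, hcard, hTc]
    omega
  obtain ⟨b, hb⟩ : ∃ b, T' \ S = {b} := by
    rw [← Finset.card_eq_one, Finset.card_sdiff_of_subset Finset.inter_subset_right, hcard, hTc']
    omega
  obtain ⟨haT, haS⟩ := Finset.mem_sdiff.1 (ha ▸ Finset.mem_singleton_self a)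
  obtain ⟨hbT, hbS⟩ := Finset.mem_sdiff.1 (hb ▸ Finset.mem_singleton_self b)
  have hTa : ∀ y ∈ T, y ∈ S ∨ y = a := fun y hy => by
    by_cases h : y ∈ S
    · exact Or.inl h
    · exact Or.inr (Finset.mem_singleton.1 (ha ▸ Finset.mem_sdiff.2 ⟨hy, h⟩))
  have hTb : ∀ y ∈ T', y ∈ S ∨ y = b := fun y hy => by
    by_cases h : y ∈ S
    · exact Or.inl h
    · exact Or.inr (Finset.mem_singleton.1 (hb ▸ Finset.mem_sdiff.2 ⟨hy, h⟩))
  have hST : S ⊆ T := Finset.inter_subset_left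
  have hST' : S ⊆ T' := Finset.inter_subset_right
  set c := barycenter S with hc
  have hcpos : (0 : ℝ) < (S.card : ℝ)⁻¹ := by
    have : 0 < S.card := by omega
    positivity
  have coord_c : ∀ (U : Finset (Eu d)) (A : Eu d → Eu d →ᵃ[ℝ] ℝ), IsCoords U A → S ⊆ U →
      ∀ y ∈ S, 0 < A y c := by
    intro U A hA hSU y hy
    rw [hc, barycenter, affineMap_sum_apply _ _ (sum_inv_card hSne), Finset.sum_eq_single y]
    · rw [hA.apply_self y (hSU hy), mul_one]
      exact hcpos
    · intro y' hy' hne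
      rw [hA.apply_ne y (hSU hy) y' (hSU hy') hne.symm, mul_zero]
    · exact fun h => absurd hy h
  have hAa : ∀ y ∈ S, A a y = 0 := fun y hy =>
    hA.apply_ne a haT y (hST hy) fun h => haS (h ▸ hy)
  have hBb : ∀ y ∈ S, B b y = 0 := fun y hy =>
    hB.apply_ne b hbT y (hST' hy) fun h => hbS (h ▸ hy)
  have hcont : ∀ L : Eu d →ᵃ[ℝ] ℝ, Continuous L := fun L => L.continuous_of_finiteDimensional
  have hN : ∀ᶠ x in 𝓝 c, ∀ y ∈ S, 0 < A y x ∧ 0 < B y x := by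
    rw [Filter.eventually_all_finset]
    intro y hy
    exact ((hcont (A y)).continuousAt.eventually (lt_mem_nhds (coord_c T A hA hST y hy))).and
      ((hcont (B y)).continuousAt.eventually (lt_mem_nhds (coord_c T' B hB hST' y hy)))
  have hβ : A a b < 0 := by
    by_contra! hβ
    -- Otherwise a point of `T'` close to the barycenter of `S` but off `S` lies in `T` as well.
    have hlim : Filter.Tendsto (fun t : ℝ => AffineMap.lineMap c b t) (𝓝[>] 0) (𝓝 c) := by
      have : Continuous fun t : ℝ => (AffineMap.lineMap c b t : Eu d) :=
        AffineMap.lineMap_continuous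
      have h := this.tendsto 0
      rw [AffineMap.lineMap_apply_zero] at h
      exact h.mono_left nhdsWithin_le_nhds
    obtain ⟨t, ht, ht0, ht1⟩ := ((hlim.eventually hN).and (Ioo_mem_nhdsGT one_pos)).exists
    set q : Eu d := AffineMap.lineMap c b t with hq
    have hlin : ∀ L : Eu d →ᵃ[ℝ] ℝ, L q = (1 - t) * L c + t * L b := by
      intro L
      rw [hq, AffineMap.apply_lineMap, AffineMap.lineMap_apply_module, smul_eq_mul, smul_eq_mul]
    have hAc : A a c = 0 := by
      rw [hc, barycenter, affineMap_sum_apply _ _ (sum_inv_card hSne)]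
      exact Finset.sum_eq_zero fun y hy => by rw [hAa y hy, mul_zero]
    have hBc : B b c = 0 := by
      rw [hc, barycenter, affineMap_sum_apply _ _ (sum_inv_card hSne)]
      exact Finset.sum_eq_zero fun y hy => by rw [hBb y hy, mul_zero]
    have hqT : q ∈ simplex T := by
      rw [hA.mem_iff]
      intro y hy
      rcases hTa y hy with h | rfl
      · exact (ht y h).1.le
      · rw [hlin, hAc]
        nlinarith
    have hqT' : q ∈ simplex T' := by
      rw [hB.mem_iff]
      intro y hy
      rcases hTb y hy with h | rfl
      · exact (ht y h).2.le
      · rw [hlin, hBc, hB.apply_self y hy]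
        nlinarith
    have hqS : q ∈ simplex S := by
      rw [hS, ← 𝒯.simplex_inter hTf hTf']
      exact ⟨hqT, hqT'⟩
    obtain ⟨u, -, hu1, hu2⟩ := Finset.mem_convexHull'.1 hqS
    have h0 : B b q = 0 := by
      rw [← hu2, affineMap_sum_apply _ _ hu1]
      exact Finset.sum_eq_zero fun y hy => by rw [hBb y hy, mul_zero]
    rw [hlin, hBc, hB.apply_self b hbT] at h0
    linarith
  have hAB : ∀ x, A a x = B b x * A a b := by
    intro x
    rw [hB.apply_eq_sum (A a) x, Finset.sum_eq_single b]
    · intro y hy hne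
      rw [hAa y ((hTb y hy).resolve_right hne), mul_zero]
    · exact fun h => absurd hbT h
  rw [mem_interior_iff_mem_nhds]
  filter_upwards [hN] with x hx
  by_cases h : 0 ≤ A a x
  · left
    rw [hA.mem_iff]
    intro y hy
    rcases hTa y hy with h' | rfl
    · exact (hx y h').1.le
    · exact h
  · right
    rw [hB.mem_iff]
    intro y hy
    rcases hTb y hy with h' | rfl
    · exact (hx y h').2.le
    · rw [hAB x] at h
      by_contra! hneg
      nlinarith

/-- A side belongs to at most two elements. -/
theorem eq_or_eq_of_inter_subset (hd : 1 ≤ d) (hT : T ∈ 𝒯.elements) (hT' : T' ∈ 𝒯.elements)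
    (hcard : (T ∩ T').card = d) {T'' : Finset (Eu d)} (hT'' : T'' ∈ 𝒯.elements)
    (hsub : T ∩ T' ⊆ T'') : T'' = T ∨ T'' = T' := by
  by_contra! h
  have hc := 𝒯.barycenter_mem_interior_union hd hT hT' hcard
  have hSne : (T ∩ T').Nonempty := Finset.card_pos.1 (by omega)
  have hc'' := simplex_mono hsub (barycenter_mem hSne)
  rw [← 𝒯.closure_interior hT'', mem_closure_iff] at hc''
  obtain ⟨x, hx, hx''⟩ := hc'' _ isOpen_interior hc
  rcases interior_subset hx with hx | hx
  · exact Set.disjoint_left.1 (𝒯.disjoint_interior_simplex hT'' hT h.1) hx'' hx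
  · exact Set.disjoint_left.1 (𝒯.disjoint_interior_simplex hT'' hT' h.2) hx'' hx

end Triangulation

/-- A Lipschitz domain lies on one side of its boundary. -/
theorem IsLipschitzDomain.interior_closure {d : ℕ} {Ω : Set (Eu d)} (hΩ : IsLipschitzDomain Ω) :
    interior (closure Ω) = Ω := by
  refine Subset.antisymm (fun x hx => ?_) (hΩ.isOpen.subset_interior_iff.2 subset_closure)
  by_contra hxΩ
  have hfr : x ∈ frontier Ω := by
    rw [hΩ.isOpen.frontier_eq]
    exact ⟨interior_subset hx, hxΩ⟩
  obtain ⟨e, he, L, g, hg, U, hU, hgr⟩ := hΩ.graph x hfr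
  have hge : inner ℝ e x ≤ g (x - inner ℝ e x • e) := by
    by_contra! h
    exact hxΩ ((hgr x (mem_of_mem_nhds hU)).2 h)
  have hlim : Filter.Tendsto (fun t : ℝ => x - t • e) (𝓝[>] 0) (𝓝 x) := by
    have : Continuous fun t : ℝ => x - t • e := by fun_prop
    have h := this.tendsto 0
    simp only [zero_smul, sub_zero] at h
    exact h.mono_left nhdsWithin_le_nhds
  have hV : interior (closure Ω) ∩ interior U ∈ 𝓝 x :=
    Filter.inter_mem (isOpen_interior.mem_nhds hx) (interior_mem_nhds.2 hU)
  obtain ⟨t, ⟨hyΩ, hyU⟩, ht⟩ := ((hlim.eventually hV).and self_mem_nhdsWithin).exists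
  set y := x - t • e with hy
  have hinner : inner ℝ e y = inner ℝ e x - t := by
    rw [hy, inner_sub_right, inner_smul_right, real_inner_self_eq_norm_sq, he]
    simp
  have hproj : y - inner ℝ e y • e = x - inner ℝ e x • e := by
    rw [hinner, hy, sub_smul]
    abel
  let G : Set (Eu d) := {w | inner ℝ e w < g (w - inner ℝ e w • e)} ∩ interior U
  have hG : IsOpen G := by
    refine IsOpen.inter (isOpen_lt (by fun_prop) (hg.continuous.comp (by fun_prop))) isOpen_interior
  have hyG : y ∈ G := by
    refine ⟨?_, hyU⟩
    change inner ℝ e y < g (y - inner ℝ e y • e)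
    rw [hproj, hinner]
    have : 0 < t := ht
    linarith
  obtain ⟨w, ⟨hw1, hw2⟩, hwΩ⟩ := mem_closure_iff.1 (interior_subset hyΩ) G hG hyG
  exact lt_asymm hw1 ((hgr w (interior_subset hw2)).1 hwΩ)

/-! ### Side-connectivity of the elements at a point -/

namespace Triangulation

variable {d : ℕ} {Ω : Set (Eu d)} (𝒯 : Triangulation Ω)

/-- The graph of the elements that contain `z`; two elements are adjacent if they share a side. -/
def sideGraph (z : Eu d) : SimpleGraph 𝒯.elements where
  Adj T T' := T ≠ T' ∧ (z ∈ simplex T.1 ∧ z ∈ simplex T'.1) ∧ (T.1 ∩ T'.1).card = d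
  symm := ⟨fun _ _ h => ⟨h.1.symm, h.2.1.symm, by rw [Finset.inter_comm]; exact h.2.2⟩⟩
  loopless := ⟨fun _ h => h.1 rfl⟩

/-- Within a convex open set `W` all elements are connected through sides: a generic segment in `W`
avoids all faces of codimension at least two, and where it passes from one class of elements to
another one, it does so through a side. -/
theorem reachable_of_convex (hΩ : IsOpen Ω) {z : Eu d} {W : Set (Eu d)} (hW : IsOpen W)
    (hWc : Convex ℝ W) (hWΩ : W ⊆ closure Ω)
    (hz : ∀ T ∈ 𝒯.elements, (simplex T ∩ W).Nonempty → z ∈ simplex T)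
    {T₁ T₂ : 𝒯.elements} (h₁ : (simplex T₁.1 ∩ W).Nonempty) (h₂ : (simplex T₂.1 ∩ W).Nonempty) :
    (𝒯.sideGraph z).Reachable T₁ T₂ := by
  have hint : ∀ T : 𝒯.elements, (simplex T.1 ∩ W).Nonempty →
      (W ∩ interior (simplex T.1)).Nonempty := by
    rintro T ⟨x, hxT, hxW⟩
    rw [← 𝒯.closure_interior T.2] at hxT
    exact mem_closure_iff.1 hxT W hW hxW
  let D : Finset (Finset (Eu d)) := 𝒯.finite_faces.toFinset.filter fun s => s.card < d
  obtain ⟨x₀, ⟨hx₀W, hx₀T⟩, hx₀⟩ : ((W ∩ interior (simplex T₁.1)) \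
      ⋃ s ∈ D, simplex s).Nonempty := by
    rw [Set.nonempty_iff_ne_empty, Ne, Set.sdiff_eq_empty]
    intro h
    refine (hW.inter isOpen_interior).measure_ne_zero volume (hint T₁ h₁) (measure_mono_null h ?_)
    exact (measure_biUnion_null_iff (Finset.countable_toSet _)).2 fun s hs =>
      volume_simplex_eq_zero (Finset.mem_filter.1 hs).2.le
  obtain ⟨x₁, ⟨hx₁W, hx₁T⟩, hx₁⟩ : ((W ∩ interior (simplex T₂.1)) \
      ⋃ s ∈ D, (affineSpan ℝ ((insert x₀ s : Finset (Eu d)) : Set (Eu d)) :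
        Set (Eu d))).Nonempty := by
    rw [Set.nonempty_iff_ne_empty, Ne, Set.sdiff_eq_empty]
    intro h
    refine (hW.inter isOpen_interior).measure_ne_zero volume (hint T₂ h₂) (measure_mono_null h ?_)
    exact (measure_biUnion_null_iff (Finset.countable_toSet _)).2 fun s hs =>
      volume_affineSpan_eq_zero
        ((Finset.card_insert_le _ _).trans (Finset.mem_filter.1 hs).2)
  -- The segment from `x₀` to `x₁` avoids the faces in `D`.
  have havoid : ∀ q ∈ segment ℝ x₀ x₁, ∀ s ∈ D, q ∉ simplex s := by
    intro q hq s hs hqs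
    rw [segment_eq_image_lineMap] at hq
    obtain ⟨t, -, rfl⟩ := hq
    have ht : t ≠ 0 := by
      rintro rfl
      rw [AffineMap.lineMap_apply_zero] at hqs
      exact hx₀ (mem_biUnion hs hqs)
    refine hx₁ (mem_biUnion hs ?_)
    have hq' : AffineMap.lineMap x₀ x₁ t ∈
        affineSpan ℝ ((insert x₀ s : Finset (Eu d)) : Set (Eu d)) :=
      affineSpan_mono ℝ (by simp) (simplex_subset_affineSpan s hqs)
    have hx₀' : x₀ ∈ affineSpan ℝ ((insert x₀ s : Finset (Eu d)) : Set (Eu d)) :=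
      subset_affineSpan ℝ _ (by simp)
    have e : x₁ = AffineMap.lineMap x₀ (AffineMap.lineMap x₀ x₁ t : Eu d) t⁻¹ := by
      rw [AffineMap.lineMap_lineMap_right, inv_mul_cancel₀ ht, AffineMap.lineMap_apply_one]
    rw [e]
    exact AffineMap.lineMap_mem _ hx₀' hq'
  have hsegW : segment ℝ x₀ x₁ ⊆ W := hWc.segment_subset hx₀W hx₁W
  by_contra hnot
  let F : Finset (Finset (Eu d)) := 𝒯.elements.filter fun T =>
    ∃ h : T ∈ 𝒯.elements, (𝒯.sideGraph z).Reachable T₁ ⟨T, h⟩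
  let F' : Finset (Finset (Eu d)) := 𝒯.elements.filter fun T =>
    ∀ h : T ∈ 𝒯.elements, ¬ (𝒯.sideGraph z).Reachable T₁ ⟨T, h⟩
  obtain ⟨q, hq, hqF, hqF'⟩ := (isPreconnected_closed_iff.1
    (convex_segment x₀ x₁).isPreconnected) (⋃ T ∈ F, simplex T) (⋃ T ∈ F', simplex T)
    (isClosed_biUnion_simplex _) (isClosed_biUnion_simplex _)
    (by
      intro q hq
      obtain ⟨T, hT, hqT⟩ := 𝒯.exists_mem_elements hΩ (hWΩ (hsegW hq))
      by_cases h : (𝒯.sideGraph z).Reachable T₁ ⟨T, hT⟩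
      · exact Or.inl (mem_biUnion (Finset.mem_filter.2 ⟨hT, hT, h⟩) hqT)
      · exact Or.inr (mem_biUnion (Finset.mem_filter.2 ⟨hT, fun _ => h⟩) hqT))
    ⟨x₀, left_mem_segment ℝ _ _, mem_biUnion
      (Finset.mem_filter.2 ⟨T₁.2, T₁.2, SimpleGraph.Reachable.refl _⟩) (interior_subset hx₀T)⟩
    ⟨x₁, right_mem_segment ℝ _ _, mem_biUnion
      (Finset.mem_filter.2 ⟨T₂.2, fun _ => hnot⟩) (interior_subset hx₁T)⟩
  obtain ⟨T, hTF, hqT⟩ := mem_iUnion₂.1 hqF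
  obtain ⟨T', hTF', hqT'⟩ := mem_iUnion₂.1 hqF'
  obtain ⟨hT, hT₀, hreach⟩ := Finset.mem_filter.1 hTF
  obtain ⟨hT', hnreach⟩ := Finset.mem_filter.1 hTF'
  have hne : T ≠ T' := by
    rintro rfl
    exact hnreach hT' hreach
  have hqS : q ∈ simplex (T ∩ T') := by
    rw [← 𝒯.simplex_inter (𝒯.mem_elements.1 hT).1 (𝒯.mem_elements.1 hT').1]
    exact ⟨hqT, hqT'⟩
  have hSne : (T ∩ T').Nonempty := by
    have := convexHull_nonempty_iff.1 ⟨q, hqS⟩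
    exact_mod_cast this
  have hcard : (T ∩ T').card = d := by
    refine le_antisymm (𝒯.card_inter_le hT hT' hne) ?_
    by_contra! hlt
    refine havoid q hq (T ∩ T') (Finset.mem_filter.2 ⟨𝒯.finite_faces.mem_toFinset.2 ?_, hlt⟩) hqS
    exact 𝒯.complex.down_closed (𝒯.mem_elements.1 hT).1 Finset.inter_subset_left hSne
  refine hnreach hT' (hreach.trans (SimpleGraph.Adj.reachable ?_))
  exact ⟨fun h => hne (congrArg Subtype.val h),
    ⟨hz T hT ⟨q, hqT, hsegW hq⟩, hz T' hT' ⟨q, hqT', hsegW hq⟩⟩, hcard⟩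

theorem reachable_of_segment (hΩ : IsOpen Ω) {z : Eu d} {O : Set (Eu d)} (hO : IsOpen O)
    (hOΩ : O ⊆ closure Ω) (hz : ∀ T ∈ 𝒯.elements, (simplex T ∩ O).Nonempty → z ∈ simplex T)
    {x y : Eu d} (hxy : segment ℝ x y ⊆ O)
    {T₁ T₂ : 𝒯.elements} (h₁ : x ∈ simplex T₁.1) (h₂ : y ∈ simplex T₂.1) :
    (𝒯.sideGraph z).Reachable T₁ T₂ := by
  have hcomp : IsCompact (segment ℝ x y) := by
    rw [← convexHull_pair]
    exact (Set.toFinite _).isCompact_convexHull ℝ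
  obtain ⟨δ, hδ, hδO⟩ := hcomp.exists_thickening_subset_open hO hxy
  have hsub := Metric.self_subset_thickening hδ (segment ℝ x y)
  exact 𝒯.reachable_of_convex hΩ Metric.isOpen_thickening ((convex_segment x y).thickening δ)
    (hδO.trans hOΩ) (fun T hT h => hz T hT (h.mono (inter_subset_inter_right _ hδO)))
    ⟨x, h₁, hsub (left_mem_segment ℝ _ _)⟩ ⟨y, h₂, hsub (right_mem_segment ℝ _ _)⟩

theorem exists_ball_elements (z : Eu d) :
    ∃ r > 0, ∀ T ∈ 𝒯.elements, (simplex T ∩ Metric.ball z r).Nonempty → z ∈ simplex T := by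
  have h := (isClosed_biUnion_simplex (𝒯.elements.filter fun T => z ∉ simplex T)).isOpen_compl
  obtain ⟨r, hr, hsub⟩ := Metric.isOpen_iff.1 h z (by simp)
  refine ⟨r, hr, fun T hT ⟨x, hxT, hx⟩ => ?_⟩
  by_contra hz
  exact hsub hx (mem_biUnion (Finset.mem_filter.2 ⟨hT, hz⟩) hxT)

/-- All elements at a point `z` are connected through sides that contain `z`. For a boundary point
the connection runs in the domain and close to `z`: from each of the two elements some distance
upwards with respect to the local graph representation of the boundary, and straight across. -/
theorem reachable_sideGraph (hΩ : IsLipschitzDomain Ω) {z : Eu d} {T₁ T₂ : 𝒯.elements}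
    (h₁ : z ∈ simplex T₁.1) (h₂ : z ∈ simplex T₂.1) : (𝒯.sideGraph z).Reachable T₁ T₂ := by
  have hzc : z ∈ closure Ω := 𝒯.simplex_subset_closure (𝒯.mem_elements.1 T₁.2).1 h₁
  obtain ⟨r₀, hr₀, hball⟩ := 𝒯.exists_ball_elements z
  by_cases hzΩ : z ∈ Ω
  · refine 𝒯.reachable_of_segment hΩ.isOpen (hΩ.isOpen.inter Metric.isOpen_ball)
      (inter_subset_left.trans subset_closure)
      (fun T hT h => hball T hT (h.mono (inter_subset_inter_right _ inter_subset_right)))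
      (x := z) (y := z) ?_ h₁ h₂
    rw [segment_same, singleton_subset_iff]
    exact ⟨hzΩ, Metric.mem_ball_self hr₀⟩
  have hfr : z ∈ frontier Ω := by
    rw [hΩ.isOpen.frontier_eq]
    exact ⟨hzc, hzΩ⟩
  obtain ⟨e, he, L, g, hg, U, hU, hgr⟩ := hΩ.graph z hfr
  obtain ⟨r₁, hr₁, hr₁U⟩ := Metric.mem_nhds_iff.1 hU
  set r := min r₀ r₁
  have hrpos : 0 < r := lt_min hr₀ hr₁
  have hL : (0 : ℝ) ≤ L := L.2
  set ε : ℝ := r / (2 * L + 4) with hε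
  have hεpos : 0 < ε := by positivity
  have hεr : ε * (2 * L + 4) = r := by
    rw [hε]
    field_simp
  set τ : ℝ := 2 * (L + 1) * ε with hτ
  have hτpos : 0 < τ := by positivity
  have hetau : ε + τ < r := by
    rw [← hεr, hτ]
    nlinarith
  have hintΩ : ∀ T : 𝒯.elements, interior (simplex T.1) ⊆ Ω := fun T => by
    conv_rhs => rw [← hΩ.interior_closure]
    exact interior_mono (𝒯.simplex_subset_closure (𝒯.mem_elements.1 T.2).1)
  have hpick : ∀ T : 𝒯.elements, z ∈ simplex T.1 →
      ∃ x ∈ interior (simplex T.1), dist x z < ε := by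
    intro T hz
    rw [← 𝒯.closure_interior T.2] at hz
    obtain ⟨x, hx, hxT⟩ := mem_closure_iff.1 hz _ Metric.isOpen_ball (Metric.mem_ball_self hεpos)
    exact ⟨x, hxT, hx⟩
  obtain ⟨x, hxT, hxz⟩ := hpick T₁ h₁
  obtain ⟨y, hyT, hyz⟩ := hpick T₂ h₂
  have hball_of : ∀ w : Eu d, dist w z < ε → ∀ t, 0 ≤ t → t ≤ τ → w + t • e ∈ Metric.ball z r := by
    intro w hw t ht0 ht
    rw [Metric.mem_ball, dist_eq_norm]
    have : w + t • e - z = (w - z) + t • e := by abel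
    rw [this]
    refine (norm_add_le _ _).trans_lt ?_
    rw [norm_smul, he, Real.norm_of_nonneg ht0, ← dist_eq_norm]
    linarith
  have hmemU : Metric.ball z r ⊆ U := (Metric.ball_subset_ball (min_le_right _ _)).trans hr₁U
  have hinn : ∀ (w : Eu d) (t : ℝ), inner ℝ e (w + t • e) = inner ℝ e w + t := by
    intro w t
    rw [inner_add_right, inner_smul_right, real_inner_self_eq_norm_sq, he]
    simp
  have hproj : ∀ (w : Eu d) (t : ℝ),
      w + t • e - inner ℝ e (w + t • e) • e = w - inner ℝ e w • e := by
    intro w t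
    rw [hinn, add_smul]
    abel
  set O : Set (Eu d) := Ω ∩ Metric.ball z r
  have hup : ∀ w : Eu d, w ∈ Ω → dist w z < ε → segment ℝ w (w + τ • e) ⊆ O := by
    intro w hwΩ hwz q hq
    have hwU : w ∈ U := hmemU (by simpa using hball_of w hwz 0 le_rfl hτpos.le)
    rw [segment_eq_image_lineMap] at hq
    obtain ⟨s, ⟨hs0, hs1⟩, rfl⟩ := hq
    have e1 : (AffineMap.lineMap w (w + τ • e) s : Eu d) = w + (s * τ) • e := by
      rw [AffineMap.lineMap_apply]
      simp [smul_smul, add_comm]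
    rw [e1]
    have hb := hball_of w hwz (s * τ) (by positivity) (mul_le_of_le_one_left hτpos.le hs1)
    refine ⟨(hgr _ (hmemU hb)).2 ?_, hb⟩
    rw [hproj, hinn]
    have := (hgr _ hwU).1 hwΩ
    have : 0 ≤ s * τ := by positivity
    linarith
  have hxΩ := hintΩ T₁ hxT
  have hyΩ := hintΩ T₂ hyT
  have hxU : x ∈ U := hmemU (by simpa using hball_of x hxz 0 le_rfl hτpos.le)
  have hacross : segment ℝ (x + τ • e) (y + τ • e) ⊆ O := by
    intro q hq
    have hb : q ∈ Metric.ball z r := (convex_ball z r).segment_subset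
      (hball_of x hxz τ hτpos.le le_rfl) (hball_of y hyz τ hτpos.le le_rfl) hq
    rw [segment_eq_image_lineMap] at hq
    obtain ⟨s, ⟨hs0, hs1⟩, rfl⟩ := hq
    set w : Eu d := AffineMap.lineMap x y s with hw
    have e1 : (AffineMap.lineMap (x + τ • e) (y + τ • e) s : Eu d) = w + τ • e := by
      rw [hw, AffineMap.lineMap_apply_module, AffineMap.lineMap_apply_module]
      module
    rw [e1] at hb ⊢
    refine ⟨(hgr _ (hmemU hb)).2 ?_, hb⟩
    rw [hproj, hinn]
    have hwx : ‖w - x‖ ≤ 2 * ε := by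
      have h1 : w - x = s • (y - x) := by
        rw [hw, AffineMap.lineMap_apply_module]
        module
      have h2 : ‖y - x‖ ≤ 2 * ε := by
        rw [← dist_eq_norm]
        have := dist_triangle_right y x z
        linarith
      rw [h1, norm_smul, Real.norm_of_nonneg hs0]
      exact (mul_le_of_le_one_left (norm_nonneg _) hs1).trans h2
    have hin : |inner ℝ e w - inner ℝ e x| ≤ 2 * ε := by
      rw [← inner_sub_right]
      refine (abs_real_inner_le_norm _ _).trans ?_
      rw [he, one_mul]
      exact hwx
    have hgl : g (w - inner ℝ e w • e) ≤ g (x - inner ℝ e x • e) + L * (2 * ε) := by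
      have h1 := hg.dist_le_mul (w - inner ℝ e w • e) (x - inner ℝ e x • e)
      rw [Real.dist_eq] at h1
      -- The projection along `e` does not increase distances.
      have h2 : dist (w - inner ℝ e w • e) (x - inner ℝ e x • e) ≤ 2 * ε := by
        rw [dist_eq_norm]
        have h3 : w - inner ℝ e w • e - (x - inner ℝ e x • e) =
            (w - x) - inner ℝ e (w - x) • e := by
          rw [inner_sub_right, sub_smul]
          abel
        rw [h3]
        refine le_trans ?_ hwx
        have h4 : ‖(w - x) - inner ℝ e (w - x) • e‖ ^ 2 =
            ‖w - x‖ ^ 2 - (inner ℝ e (w - x)) ^ 2 := by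
          rw [@norm_sub_sq ℝ, norm_smul, he, inner_smul_right, real_inner_comm]
          simp only [RCLike.re_to_real, Real.norm_eq_abs, mul_one, sq_abs]
          ring
        refine (sq_le_sq₀ (norm_nonneg _) (norm_nonneg _)).1 ?_
        rw [h4]
        exact sub_le_self _ (sq_nonneg _)
      have h5 := mul_le_mul_of_nonneg_left h2 hL
      have h6 := le_abs_self (g (w - inner ℝ e w • e) - g (x - inner ℝ e x • e))
      linarith
    have hgx := (hgr _ hxU).1 hxΩ
    have := (abs_le.1 hin).1
    rw [hτ]
    nlinarith
  have hOΩ : O ⊆ closure Ω := inter_subset_left.trans subset_closure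
  have hOpen : IsOpen O := hΩ.isOpen.inter Metric.isOpen_ball
  have hOz : ∀ T ∈ 𝒯.elements, (simplex T ∩ O).Nonempty → z ∈ simplex T := fun T hT h =>
    hball T hT (h.mono (inter_subset_inter_right _
      (inter_subset_right.trans (Metric.ball_subset_ball (min_le_left _ _)))))
  obtain ⟨T₃, hT₃, h₃⟩ := 𝒯.exists_mem_elements hΩ.isOpen
    (hOΩ (hacross (left_mem_segment ℝ _ _)))
  obtain ⟨T₄, hT₄, h₄⟩ := 𝒯.exists_mem_elements hΩ.isOpen
    (hOΩ (hacross (right_mem_segment ℝ _ _)))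
  have r1 := 𝒯.reachable_of_segment hΩ.isOpen hOpen hOΩ hOz (hup x hxΩ hxz)
    (interior_subset hxT) (T₂ := ⟨T₃, hT₃⟩) h₃
  have r2 := 𝒯.reachable_of_segment hΩ.isOpen hOpen hOΩ hOz hacross
    (T₁ := ⟨T₃, hT₃⟩) (T₂ := ⟨T₄, hT₄⟩) h₃ h₄
  have r3 := 𝒯.reachable_of_segment hΩ.isOpen hOpen hOΩ hOz (hup y hyΩ hyz)
    (interior_subset hyT) (T₂ := ⟨T₄, hT₄⟩) h₄
  exact (r1.trans r2).trans r3.symm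

end Triangulation

/-! ### Nodal errors and jumps -/

theorem IsPoly.add {d k : ℕ} {p q : Eu d → ℝ} (hp : IsPoly k p) (hq : IsPoly k q) :
    IsPoly k (fun x => p x + q x) := by
  obtain ⟨P, hP, hp⟩ := hp
  obtain ⟨Q, hQ, hq⟩ := hq
  exact ⟨P + Q, (MvPolynomial.totalDegree_add _ _).trans (max_le hP hQ),
    fun x => by simp only [map_add, hp, hq]⟩

theorem IsPoly.mul_const {d k : ℕ} {p : Eu d → ℝ} (hp : IsPoly k p) (c : ℝ) :
    IsPoly k (fun x => p x * c) := by
  obtain ⟨P, hP, hp⟩ := hp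
  exact ⟨c • P, (MvPolynomial.totalDegree_smul_le _ _).trans hP,
    fun x => by simp only [MvPolynomial.smul_eval, hp, mul_comm]⟩

theorem IsPoly.zero {d : ℕ} (k : ℕ) : IsPoly k (fun _ : Eu d => 0) :=
  ⟨0, by simp, fun x => by simp⟩

theorem IsPolyVec.sub {d l k : ℕ} {p q : Eu d → Eu l} (hp : IsPolyVec k p) (hq : IsPolyVec k q) :
    IsPolyVec k (fun x => p x - q x) := fun i => by
  simpa [sub_eq_add_neg] using (hp i).add ((hq i).mul_const (-1))

theorem isPolyVec_sum_smul {d l k : ℕ} {ι : Type*} (s : Finset ι) {p : ι → Eu d → ℝ}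
    (hp : ∀ i ∈ s, IsPoly k (p i)) (c : ι → Eu l) :
    IsPolyVec k (fun x => ∑ i ∈ s, p i x • c i) := by
  intro j
  simp only [WithLp.ofLp_sum, Finset.sum_apply, WithLp.ofLp_smul, Pi.smul_apply, smul_eq_mul]
  induction s using Finset.induction_on with
  | empty => simpa using IsPoly.zero k
  | insert a s ha ih =>
    simp only [Finset.sum_insert ha]
    exact ((hp a (Finset.mem_insert_self a s)).mul_const _).add
      (ih fun i hi => hp i (Finset.mem_insert_of_mem hi))

namespace Triangulation

variable {d l : ℕ} {Ω : Set (Eu d)} (𝒯 : Triangulation Ω)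

theorem MemL.piece_spec {𝒯 : Triangulation Ω} {k : ℕ} {v : Eu d → Eu l} (hv : 𝒯.MemL k v)
    {T : Finset (Eu d)} (hT : T ∈ 𝒯.elements) :
    IsPolyVec k (piece k v T) ∧ ∀ᵐ x ∂(volume.restrict (simplex T)), v x = piece k v T x :=
  Classical.epsilon_spec (hv T hT)

theorem jump_inter_eq (hd : 1 ≤ d) (hΩ : IsLipschitzDomain Ω) {k : ℕ} {v : Eu d → Eu l}
    {T T' : Finset (Eu d)} (hT : T ∈ 𝒯.elements) (hT' : T' ∈ 𝒯.elements) (hne : T ≠ T')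
    (hcard : (T ∩ T').card = d) :
    (𝒯.jump k v (T ∩ T') = fun x => piece k v T x - piece k v T' x) ∨
      𝒯.jump k v (T ∩ T') = fun x => piece k v T' x - piece k v T x := by
  have hSne : (T ∩ T').Nonempty := Finset.card_pos.1 (by omega)
  have hnot : ¬ simplex (T ∩ T') ⊆ frontier Ω := by
    intro h
    have h1 := h (barycenter_mem hSne)
    have h2 : barycenter (T ∩ T') ∈ interior (closure Ω) :=
      interior_mono (union_subset (𝒯.simplex_subset_closure (𝒯.mem_elements.1 hT).1)
        (𝒯.simplex_subset_closure (𝒯.mem_elements.1 hT').1))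
        (𝒯.barycenter_mem_interior_union hd hT hT' hcard)
    rw [hΩ.interior_closure] at h2
    rw [hΩ.isOpen.frontier_eq] at h1
    exact h1.2 h2
  have hjump : 𝒯.jump k v (T ∩ T') = fun x =>
      let P : Finset (Eu d) × Finset (Eu d) := Classical.epsilon fun P =>
        P.1 ∈ 𝒯.elements ∧ P.2 ∈ 𝒯.elements ∧ P.1 ≠ P.2 ∧ T ∩ T' ⊆ P.1 ∧ T ∩ T' ⊆ P.2
      piece k v P.1 x - piece k v P.2 x := funext fun x => if_neg hnot
  rw [hjump]
  have hP := Classical.epsilon_spec (p := fun P : Finset (Eu d) × Finset (Eu d) =>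
      P.1 ∈ 𝒯.elements ∧ P.2 ∈ 𝒯.elements ∧ P.1 ≠ P.2 ∧ T ∩ T' ⊆ P.1 ∧ T ∩ T' ⊆ P.2)
    ⟨(T, T'), hT, hT', hne, Finset.inter_subset_left, Finset.inter_subset_right⟩
  set P := Classical.epsilon (fun P : Finset (Eu d) × Finset (Eu d) =>
      P.1 ∈ 𝒯.elements ∧ P.2 ∈ 𝒯.elements ∧ P.1 ≠ P.2 ∧ T ∩ T' ⊆ P.1 ∧ T ∩ T' ⊆ P.2)
  obtain ⟨h1, h2, h3, h4, h5⟩ := hP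
  rcases 𝒯.eq_or_eq_of_inter_subset hd hT hT' hcard h1 h4 with e1 | e1 <;>
    rcases 𝒯.eq_or_eq_of_inter_subset hd hT hT' hcard h2 h5 with e2 | e2
  · exact absurd (e1.trans e2.symm) h3
  · left
    simp only [e1, e2]
  · right
    simp only [e1, e2]
  · exact absurd (e1.trans e2.symm) h3

theorem inter_mem_sidesNear (hd : 1 ≤ d) (ΓD : Set (Eu d)) {z : Eu d} {T T₁ T₂ : Finset (Eu d)}
    (hT : z ∈ simplex T) (h₁ : T₁ ∈ 𝒯.elements) (h₂ : T₂ ∈ 𝒯.elements) (hz₁ : z ∈ simplex T₁)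
    (hz₂ : z ∈ simplex T₂) (hcard : (T₁ ∩ T₂).card = d) : T₁ ∩ T₂ ∈ 𝒯.sidesNear ΓD T := by
  refine Finset.mem_filter.2 ⟨𝒯.inter_mem_sides hd h₁ hcard, Or.inl ⟨barycenter (T₁ ∩ T₂),
    barycenter_mem (Finset.card_pos.1 (by omega)), ?_⟩⟩
  refine interior_mono (union_subset ?_ ?_) (𝒯.barycenter_mem_interior_union hd h₁ h₂ hcard)
  · exact subset_biUnion_of_mem (u := fun T' : Finset (Eu d) => simplex T')
      (Finset.mem_coe.2 (Finset.mem_filter.2 ⟨h₁, z, hz₁, hT⟩))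
  · exact subset_biUnion_of_mem (u := fun T' : Finset (Eu d) => simplex T')
      (Finset.mem_coe.2 (Finset.mem_filter.2 ⟨h₂, z, hz₂, hT⟩))

/-- The traces at `z` from two elements at `z` differ by at most the sum of the jumps along a chain
of elements. -/
theorem norm_piece_sub_le (hd : 1 ≤ d) (hΩ : IsLipschitzDomain Ω) (ΓD : Set (Eu d)) {k : ℕ}
    {v : Eu d → Eu l} (hv : 𝒯.MemL k v) {z : Eu d} {T : Finset (Eu d)} (hT : z ∈ simplex T)
    {R : ℝ} (hR : 0 ≤ R)
    (hjump : ∀ S ∈ 𝒯.sidesNear ΓD T, IsPolyVec k (𝒯.jump k v S) → z ∈ simplex S → ‖𝒯.jump k v S z‖ ≤ R)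
    {T₁ T₂ : Finset (Eu d)} (h₁ : T₁ ∈ 𝒯.elementsAt z) (h₂ : T₂ ∈ 𝒯.elementsAt z) :
    ‖piece k v T₁ z - piece k v T₂ z‖ ≤ (𝒯.elementsAt z).card * R := by
  rw [mem_elementsAt] at h₁ h₂
  obtain ⟨p, hp⟩ := (𝒯.reachable_sideGraph hΩ (T₁ := ⟨T₁, h₁.1⟩) (T₂ := ⟨T₂, h₂.1⟩)
    h₁.2 h₂.2).exists_isPath
  have hwalk : ∀ {A B : 𝒯.elements} (q : (𝒯.sideGraph z).Walk A B),
      ‖piece k v A.1 z - piece k v B.1 z‖ ≤ q.length * R := by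
    intro A B q
    induction q with
    | nil => simp
    | @cons A B C h q ih =>
      have hAB := h
      obtain ⟨hne, ⟨hzA, hzB⟩, hcard⟩ := hAB
      have hS : z ∈ simplex (A.1 ∩ B.1) := by
        rw [← 𝒯.simplex_inter (𝒯.mem_elements.1 A.2).1 (𝒯.mem_elements.1 B.2).1]
        exact ⟨hzA, hzB⟩
      have h1 : ‖piece k v A.1 z - piece k v B.1 z‖ ≤ R := by
        have h0 := hjump _ (𝒯.inter_mem_sidesNear hd ΓD hT A.2 B.2 hzA hzB hcard)
        rcases 𝒯.jump_inter_eq hd hΩ A.2 B.2 (fun h => hne (Subtype.ext h)) hcard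
          (k := k) (v := v) with e | e
        · rw [e] at h0
          exact h0 ((hv.piece_spec A.2).1.sub (hv.piece_spec B.2).1) hS
        · rw [e] at h0
          rw [norm_sub_rev]
          exact h0 ((hv.piece_spec B.2).1.sub (hv.piece_spec A.2).1) hS
      have h2 := norm_sub_le_norm_sub_add_norm_sub (piece k v A.1 z) (piece k v B.1 z)
        (piece k v C.1 z)
      rw [SimpleGraph.Walk.length_cons]
      push_cast
      linarith
  refine (hwalk p).trans (mul_le_mul_of_nonneg_right ?_ hR)
  -- A path visits each of the elements at `z` at most once.
  have hsupp : ∀ {A B : 𝒯.elements} (q : (𝒯.sideGraph z).Walk A B), z ∈ simplex A.1 →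
      ∀ C ∈ q.support, C.1 ∈ 𝒯.elementsAt z := by
    intro A B q
    induction q with
    | nil =>
      intro hA C hC
      rw [SimpleGraph.Walk.support_nil, List.mem_singleton] at hC
      subst hC
      exact 𝒯.mem_elementsAt.2 ⟨C.2, hA⟩
    | @cons A B D h q ih =>
      intro hA C hC
      rw [SimpleGraph.Walk.support_cons, List.mem_cons] at hC
      rcases hC with rfl | hC
      · exact 𝒯.mem_elementsAt.2 ⟨C.2, hA⟩
      · exact ih h.2.1.2 C hC
  have hnd : (p.support.map Subtype.val).Nodup :=
    (List.nodup_map_iff Subtype.val_injective).2 hp.support_nodup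
  have hle : (p.support.map Subtype.val).toFinset ⊆ 𝒯.elementsAt z := by
    intro C hC
    rw [List.mem_toFinset, List.mem_map] at hC
    obtain ⟨C, hC, rfl⟩ := hC
    exact hsupp p h₁.2 C hC
  have := Finset.card_le_card hle
  rw [List.toFinset_card_of_nodup hnd, List.length_map, SimpleGraph.Walk.length_support] at this
  exact_mod_cast (Nat.le_succ _).trans this

/-- At a node `z` of an element `T`, the trace from `T` differs from the nodal average by at most
the jumps at `z`. If `z` lies in the Dirichlet part, a chain of elements leads from `T` to an
element with a side in the Dirichlet part, where the trace itself is a jump. -/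
theorem norm_piece_sub_nodalAverage_le (hd : 1 ≤ d) (hΩ : IsLipschitzDomain Ω) {ΓD : Set (Eu d)}
    (hΓ : ΓD ⊆ frontier Ω) (hres : 𝒯.Resolves ΓD) {k : ℕ} {v : Eu d → Eu l}
    (hv : 𝒯.MemL k v) {z : Eu d} {T : Finset (Eu d)} (hT : T ∈ 𝒯.elements) (hz : z ∈ simplex T)
    {R : ℝ} (hR : 0 ≤ R)
    (hjump : ∀ S ∈ 𝒯.sidesNear ΓD T, IsPolyVec k (𝒯.jump k v S) → z ∈ simplex S → ‖𝒯.jump k v S z‖ ≤ R) :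
    ‖piece k v T z - 𝒯.nodalAverage k ΓD v z‖ ≤ ((𝒯.elementsAt z).card + 1) * R := by
  have hTz : T ∈ 𝒯.elementsAt z := 𝒯.mem_elementsAt.2 ⟨hT, hz⟩
  rw [nodalAverage]
  split_ifs with hzD
  · obtain ⟨S, hS, hzS, hSΓ⟩ := hres z hzD
    have hSnear : S ∈ 𝒯.sidesNear ΓD T := Finset.mem_filter.2 ⟨hS, Or.inr ⟨hSΓ, z, hzS, hz⟩⟩
    have hT' := Classical.epsilon_spec (p := fun T => T ∈ 𝒯.elements ∧ S ⊆ T)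
      (𝒯.exists_subset_element hΩ.isOpen (𝒯.mem_sides.1 hS).1)
    have hSj : 𝒯.jump k v S = piece k v (Classical.epsilon fun T => T ∈ 𝒯.elements ∧ S ⊆ T) :=
      funext fun x => if_pos (hSΓ.trans hΓ)
    set T' := Classical.epsilon fun T => T ∈ 𝒯.elements ∧ S ⊆ T
    have h1 := hjump S hSnear
    rw [hSj] at h1
    replace h1 := h1 (hv.piece_spec hT'.1).1 hzS
    have h2 := 𝒯.norm_piece_sub_le hd hΩ ΓD hv hz hR hjump hTz
      (𝒯.mem_elementsAt.2 ⟨hT'.1, simplex_mono hT'.2 hzS⟩)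
    have h3 := norm_sub_norm_le (piece k v T z) (piece k v T' z)
    rw [sub_zero]
    linarith
  · have hcard : ((𝒯.elementsAt z).card : ℝ) ≠ 0 := by
      exact_mod_cast (Finset.card_pos.2 ⟨T, hTz⟩).ne'
    have e : piece k v T z - ((𝒯.elementsAt z).card : ℝ)⁻¹ •
        ∑ T' ∈ 𝒯.elementsAt z, piece k v T' z = ((𝒯.elementsAt z).card : ℝ)⁻¹ •
        ∑ T' ∈ 𝒯.elementsAt z, (piece k v T z - piece k v T' z) := by
      rw [Finset.sum_sub_distrib, smul_sub, Finset.sum_const, ← Nat.cast_smul_eq_nsmul ℝ,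
        inv_smul_smul₀ hcard]
    rw [e, norm_smul, norm_inv, Real.norm_natCast]
    have h1 : ‖∑ T' ∈ 𝒯.elementsAt z, (piece k v T z - piece k v T' z)‖ ≤
        (𝒯.elementsAt z).card * ((𝒯.elementsAt z).card * R) := by
      rw [← nsmul_eq_mul]
      refine (norm_sum_le _ _).trans (Finset.sum_le_card_nsmul _ _ _ fun T' hT' => ?_)
      exact 𝒯.norm_piece_sub_le hd hΩ ΓD hv hz hR hjump hTz hT'
    calc _ ≤ ((𝒯.elementsAt z).card : ℝ)⁻¹ *
          ((𝒯.elementsAt z).card * ((𝒯.elementsAt z).card * R)) := by gcongr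
      _ = (𝒯.elementsAt z).card * R := by rw [inv_mul_cancel_left₀ hcard]
      _ ≤ _ := by linarith

/-! ### The number of elements at a point -/

theorem diam_pos (hd : 1 ≤ d) {T : Finset (Eu d)} (hT : T ∈ 𝒯.elements) :
    0 < Metric.diam (simplex T) := by
  have hcard := (𝒯.mem_elements.1 hT).2
  obtain ⟨a, ha, b, hb, hab⟩ := Finset.one_lt_card.1 (by omega : 1 < T.card)
  exact (dist_pos.2 hab).trans_le (Metric.dist_le_diam_of_mem (isCompact_simplex T).isBounded
    (subset_convexHull ℝ _ ha) (subset_convexHull ℝ _ hb))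

/-- An element of a shape regular triangulation contains a ball of radius comparable to its
diameter. The constant `4` leaves room for a supremum that need not be known to be attained. -/
theorem ShapeRegular.exists_closedBall_subset {𝒯 : Triangulation Ω} {κ : ℝ}
    (h : 𝒯.ShapeRegular κ) (hd : 1 ≤ d) {T : Finset (Eu d)} (hT : T ∈ 𝒯.elements) :
    0 < κ ∧ ∃ x₀, Metric.closedBall x₀ (Metric.diam (simplex T) / (4 * κ)) ⊆ simplex T := by
  have hdiam := 𝒯.diam_pos hd hT
  have hle := h T hT
  have hne : {ρ : ℝ | 0 ≤ ρ ∧ ∃ x, Metric.closedBall x (ρ / 2) ⊆ simplex T}.Nonempty := by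
    obtain ⟨x, hx⟩ := 𝒯.interior_nonempty hT
    exact ⟨0, le_rfl, x, by simpa using interior_subset hx⟩
  have hin : 0 ≤ inDiam T := Real.sSup_nonneg fun ρ hρ => hρ.1
  have hκ : 0 < κ := by
    by_contra! hκ
    linarith [mul_nonpos_of_nonpos_of_nonneg hκ hin]
  refine ⟨hκ, ?_⟩
  have hlt : Metric.diam (simplex T) / (2 * κ) < inDiam T := by
    have h1 : Metric.diam (simplex T) / κ ≤ inDiam T := by
      rw [div_le_iff₀ hκ]
      linarith
    have h2 : Metric.diam (simplex T) / (2 * κ) < Metric.diam (simplex T) / κ :=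
      div_lt_div_of_pos_left hdiam hκ (by linarith)
    linarith
  obtain ⟨ρ, ⟨-, x, hx⟩, hρ⟩ := exists_lt_of_lt_csSup hne hlt
  refine ⟨x, (Metric.closedBall_subset_closedBall ?_).trans hx⟩
  have : Metric.diam (simplex T) / (4 * κ) = Metric.diam (simplex T) / (2 * κ) / 2 := by
    field_simp
    ring
  rw [this]
  linarith

/-- The number of elements at a point is bounded in terms of the shape regularity. After scaling
with center `z`, all these elements contain balls of equal size close to `z`, and these balls are
disjoint. -/
theorem ShapeRegular.card_elementsAt_le {𝒯 : Triangulation Ω} {κ : ℝ} (h : 𝒯.ShapeRegular κ)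
    (hd : 1 ≤ d) {z : Eu d} (hne : (𝒯.elementsAt z).Nonempty) :
    ((𝒯.elementsAt z).card : ℝ) ≤ (4 * κ) ^ d := by
  obtain ⟨T₀, hT₀, hmin⟩ := (𝒯.elementsAt z).exists_min_image
    (fun T => Metric.diam (simplex T)) hne
  set r := Metric.diam (simplex T₀)
  have hrpos : 0 < r := 𝒯.diam_pos hd (𝒯.mem_elementsAt.1 hT₀).1
  have hκ : 0 < κ := (h.exists_closedBall_subset hd (𝒯.mem_elementsAt.1 hT₀).1).1
  have hδpos : 0 < r / (4 * κ) := by positivity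
  have hexists : ∀ T ∈ 𝒯.elementsAt z, ∃ c, Metric.ball c (r / (4 * κ)) ⊆
      simplex T ∩ Metric.closedBall z r := by
    intro T hT
    obtain ⟨hTe, hzT⟩ := 𝒯.mem_elementsAt.1 hT
    obtain ⟨-, x, hx⟩ := h.exists_closedBall_subset hd hTe
    have hhpos := 𝒯.diam_pos hd hTe
    have hrh : r ≤ Metric.diam (simplex T) := hmin T hT
    set D := Metric.diam (simplex T)
    refine ⟨z + (r / D) • (x - z), fun y hy => ?_⟩
    set y' : Eu d := z + (D / r) • (y - z) with hy'
    have e1 : y = z + (r / D) • (y' - z) := by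
      rw [hy', add_sub_cancel_left, smul_smul, div_mul_div_cancel₀ hhpos.ne', div_self hrpos.ne',
        one_smul, add_sub_cancel]
    have hy'T : y' ∈ simplex T := by
      refine hx ?_
      rw [Metric.mem_closedBall, dist_eq_norm]
      have e2 : y' - x = (D / r) • (y - (z + (r / D) • (x - z))) := by
        have : (D / r) • (r / D) • (x - z) = x - z := by
          rw [smul_smul, div_mul_div_cancel₀ hrpos.ne', div_self hhpos.ne', one_smul]
        rw [sub_add_eq_sub_sub, smul_sub, this, hy']
        abel
      rw [Metric.mem_ball, dist_eq_norm] at hy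
      rw [e2, norm_smul, Real.norm_of_nonneg (by positivity)]
      calc D / r * ‖y - (z + (r / D) • (x - z))‖ ≤ D / r * (r / (4 * κ)) := by gcongr
        _ = D / (4 * κ) := by field_simp
    have hrD : r / D ≤ 1 := div_le_one_of_le₀ hrh hhpos.le
    constructor
    · rw [e1]
      exact (convex_simplex T).add_smul_sub_mem hzT hy'T ⟨by positivity, hrD⟩
    · rw [Metric.mem_closedBall, dist_eq_norm, e1, add_sub_cancel_left, norm_smul,
        Real.norm_of_nonneg (by positivity), ← dist_eq_norm]
      have := Metric.dist_le_diam_of_mem (isCompact_simplex T).isBounded hy'T hzT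
      calc r / D * dist y' z ≤ r / D * D := by gcongr
        _ = r := by field_simp
  choose! c hc using hexists
  have hdisj : Set.PairwiseDisjoint (↑(𝒯.elementsAt z))
      (fun T => Metric.ball (c T) (r / (4 * κ))) := by
    intro T hT T' hT' hTT'
    refine (𝒯.disjoint_interior_simplex (𝒯.mem_elementsAt.1 hT).1 (𝒯.mem_elementsAt.1 hT').1
      hTT').mono ?_ ((hc T' hT').trans inter_subset_left)
    exact Metric.isOpen_ball.subset_interior_iff.2 ((hc T hT).trans inter_subset_left)
  have hvol : ∑ T ∈ 𝒯.elementsAt z, volume (Metric.ball (c T) (r / (4 * κ))) ≤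
      volume (Metric.closedBall z r) := by
    rw [← measure_biUnion_finset hdisj fun _ _ => measurableSet_ball]
    exact measure_mono (iUnion₂_subset fun T hT => (hc T hT).trans inter_subset_right)
  have hball : ∀ x : Eu d, volume (Metric.ball x (r / (4 * κ))) =
      ENNReal.ofReal ((r / (4 * κ)) ^ d) * volume (Metric.ball (0 : Eu d) 1) := by
    intro x
    rw [Measure.addHaar_ball_of_pos _ _ hδpos, finrank_euclideanSpace, Fintype.card_fin]
  rw [Finset.sum_congr rfl fun T _ => hball (c T), Finset.sum_const, nsmul_eq_mul,
    Measure.addHaar_closedBall _ _ hrpos.le, finrank_euclideanSpace, Fintype.card_fin,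
    ← mul_assoc] at hvol
  rw [ENNReal.mul_le_mul_iff_left (Metric.measure_ball_pos _ _ one_pos).ne'
    measure_ball_lt_top.ne, ← ENNReal.ofReal_natCast, ← ENNReal.ofReal_mul (by positivity),
    ENNReal.ofReal_le_ofReal_iff (by positivity), div_pow, mul_div_assoc',
    div_le_iff₀ (by positivity)] at hvol
  exact le_of_mul_le_mul_right (by linarith) (pow_pos hrpos d)

end Triangulation

/-! ### Shifted N-functions -/

/-- What the proof uses of a shifted N-function: on `[0, ∞)` it is nonnegative and nondecreasing,
it vanishes at `0`, and it is doubling with constant `K`. -/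
structure IsDoubling (K : ℝ) (ψ : ℝ → ℝ) : Prop where
  map_zero : ψ 0 = 0
  monotoneOn : MonotoneOn ψ (Ici 0)
  map_two_mul_le : ∀ t, 0 ≤ t → ψ (2 * t) ≤ K * ψ t

section

variable {φ : ℝ → ℝ}

theorem rightDeriv_mono (hφ : IsNFunction φ) {s t : ℝ} (hs : 0 < s) (hst : s ≤ t) :
    rightDeriv φ s ≤ rightDeriv φ t := by
  have h := hφ.convexOn.monotoneOn_rightDeriv
  rw [interior_Ici] at h
  exact h hs (hs.trans_le hst) hst

theorem div_le_rightDeriv (hφ : IsNFunction φ) {t : ℝ} (ht : 0 < t) : φ t / t ≤ rightDeriv φ t := by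
  have hint : t ∈ interior (Ici (0 : ℝ)) := by rwa [interior_Ici]
  have h1 := hφ.convexOn.slope_le_leftDeriv_of_mem_interior (mem_Ici.2 le_rfl) hint ht
  rw [slope_def_field, hφ.map_zero, sub_zero, sub_zero] at h1
  exact h1.trans (hφ.convexOn.leftDeriv_le_rightDeriv_of_mem_interior hint)

theorem rightDeriv_nonneg (hφ : IsNFunction φ) {t : ℝ} (ht : 0 < t) : 0 ≤ rightDeriv φ t :=
  (div_nonneg (hφ.pos t ht).le ht.le).trans (div_le_rightDeriv hφ ht)

theorem rightDeriv_le_div (hφ : IsNFunction φ) {t : ℝ} (ht : 0 < t) :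
    rightDeriv φ t ≤ φ (2 * t) / t := by
  have hint : t ∈ interior (Ici (0 : ℝ)) := by rwa [interior_Ici]
  have h := hφ.convexOn.rightDeriv_le_slope_of_mem_interior (y := 2 * t) hint
    (mem_Ici.2 (by linarith)) (by linarith)
  rw [slope_def_field, show 2 * t - t = t by ring] at h
  refine h.trans (div_le_div_of_nonneg_right ?_ ht.le)
  linarith [hφ.pos t ht]

theorem rightDeriv_two_mul_le (hφ : IsNFunction φ) {C : ℝ} (hC0 : 0 < C)
    (hC : ∀ t, 0 ≤ t → φ (2 * t) ≤ C * φ t) {t : ℝ} (ht : 0 < t) :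
    rightDeriv φ (2 * t) ≤ C ^ 2 * rightDeriv φ t := by
  have h1 := rightDeriv_le_div hφ (by linarith : 0 < 2 * t)
  have h2 : φ (2 * (2 * t)) ≤ C ^ 2 * φ t := by
    have a := hC (2 * t) (by linarith)
    have b := mul_le_mul_of_nonneg_left (hC t ht.le) hC0.le
    nlinarith
  have h3 := mul_le_mul_of_nonneg_left (div_le_rightDeriv hφ ht) (sq_nonneg C)
  have hp := hφ.pos t ht
  calc rightDeriv φ (2 * t) ≤ C ^ 2 * φ t / (2 * t) :=
        h1.trans (div_le_div_of_nonneg_right h2 (by linarith))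
    _ ≤ C ^ 2 * φ t / t := div_le_div_of_nonneg_left (by positivity) ht (by linarith)
    _ = C ^ 2 * (φ t / t) := mul_div_assoc _ _ _
    _ ≤ _ := h3

/-- The integrand that defines the shifted N-function `φ_a`. -/
def shiftedDensity (φ : ℝ → ℝ) (a s : ℝ) : ℝ := rightDeriv φ (a + s) * (s / (a + s))

theorem shiftedDensity_nonneg (hφ : IsNFunction φ) {a s : ℝ} (ha : 0 ≤ a) (hs : 0 ≤ s) :
    0 ≤ shiftedDensity φ a s := by
  rcases hs.eq_or_lt with rfl | hs
  · simp [shiftedDensity]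
  · exact mul_nonneg (rightDeriv_nonneg hφ (by linarith)) (by positivity)

theorem shiftedDensity_monotoneOn (hφ : IsNFunction φ) {a : ℝ} (ha : 0 ≤ a) :
    MonotoneOn (shiftedDensity φ a) (Ici 0) := by
  intro s hs t ht hst
  rw [mem_Ici] at hs ht
  rcases hs.eq_or_lt with rfl | hs
  · refine le_of_eq_of_le ?_ (shiftedDensity_nonneg hφ ha ht)
    simp [shiftedDensity]
  · refine mul_le_mul (rightDeriv_mono hφ (by linarith) (by linarith)) ?_ (by positivity)
      (rightDeriv_nonneg hφ (by linarith))
    rw [div_le_div_iff₀ (by linarith) (by linarith)]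
    nlinarith

theorem shiftedDensity_two_mul_le (hφ : IsNFunction φ) {C : ℝ} (hC0 : 0 < C)
    (hC : ∀ t, 0 ≤ t → φ (2 * t) ≤ C * φ t) {a s : ℝ} (ha : 0 ≤ a) (hs : 0 ≤ s) :
    shiftedDensity φ a (2 * s) ≤ 2 * C ^ 2 * shiftedDensity φ a s := by
  rcases hs.eq_or_lt with rfl | hs
  · simp [shiftedDensity]
  have h1 : rightDeriv φ (a + 2 * s) ≤ C ^ 2 * rightDeriv φ (a + s) :=
    (rightDeriv_mono hφ (by linarith) (by linarith : a + 2 * s ≤ 2 * (a + s))).trans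
      (rightDeriv_two_mul_le hφ hC0 hC (by linarith))
  have h2 : 2 * s / (a + 2 * s) ≤ 2 * (s / (a + s)) := by
    rw [← mul_div_assoc]
    exact div_le_div_of_nonneg_left (by linarith) (by linarith) (by linarith)
  have h3 := rightDeriv_nonneg hφ (by linarith : 0 < a + s)
  calc shiftedDensity φ a (2 * s) ≤ C ^ 2 * rightDeriv φ (a + s) * (2 * (s / (a + s))) :=
        mul_le_mul h1 h2 (by positivity) (by positivity)
    _ = _ := by rw [shiftedDensity]; ring

theorem shiftedDensity_intervalIntegrable (hφ : IsNFunction φ) {a : ℝ} (ha : 0 ≤ a) {s t : ℝ}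
    (hs : 0 ≤ s) (ht : 0 ≤ t) : IntervalIntegrable (shiftedDensity φ a) volume s t := by
  refine MonotoneOn.intervalIntegrable ((shiftedDensity_monotoneOn hφ ha).mono ?_)
  intro x hx
  exact (le_min hs ht).trans hx.1

theorem shifted_monotoneOn (hφ : IsNFunction φ) {a : ℝ} (ha : 0 ≤ a) :
    MonotoneOn (shifted φ a) (Ici 0) := by
  intro s hs t ht hst
  rw [mem_Ici] at hs ht
  have h := intervalIntegral.integral_add_adjacent_intervals
    (shiftedDensity_intervalIntegrable hφ ha le_rfl hs)
    (shiftedDensity_intervalIntegrable hφ ha hs ht)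
  have h0 : 0 ≤ ∫ x in s..t, shiftedDensity φ a x :=
    intervalIntegral.integral_nonneg hst fun x hx =>
      shiftedDensity_nonneg hφ ha (hs.trans hx.1)
  change (∫ x in (0 : ℝ)..s, shiftedDensity φ a x) ≤ ∫ x in (0 : ℝ)..t, shiftedDensity φ a x
  linarith

theorem shifted_two_mul_le (hφ : IsNFunction φ) {C : ℝ} (hC0 : 0 < C)
    (hC : ∀ t, 0 ≤ t → φ (2 * t) ≤ C * φ t) {a t : ℝ} (ha : 0 ≤ a) (ht : 0 ≤ t) :
    shifted φ a (2 * t) ≤ 4 * C ^ 2 * shifted φ a t := by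
  have h1 : shifted φ a (2 * t) = 2 * ∫ x in (0 : ℝ)..t, shiftedDensity φ a (2 * x) := by
    rw [intervalIntegral.integral_comp_mul_left _ two_ne_zero, smul_eq_mul, mul_zero,
      mul_inv_cancel_left₀ two_ne_zero]
    rfl
  have hint2 : IntervalIntegrable (fun x => shiftedDensity φ a (2 * x)) volume 0 t := by
    refine MonotoneOn.intervalIntegrable fun x hx y hy hxy => ?_
    rw [uIcc_of_le ht] at hx hy
    exact shiftedDensity_monotoneOn hφ ha (mem_Ici.2 (by linarith [hx.1]))
      (mem_Ici.2 (by linarith [hy.1])) (by linarith)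
  have h2 : ∫ x in (0 : ℝ)..t, shiftedDensity φ a (2 * x) ≤
      ∫ x in (0 : ℝ)..t, 2 * C ^ 2 * shiftedDensity φ a x :=
    intervalIntegral.integral_mono_on ht hint2
      ((shiftedDensity_intervalIntegrable hφ ha le_rfl ht).const_mul _)
      fun x hx => shiftedDensity_two_mul_le hφ hC0 hC ha hx.1
  rw [intervalIntegral.integral_const_mul] at h2
  rw [h1]
  change _ ≤ 4 * C ^ 2 * ∫ x in (0 : ℝ)..t, shiftedDensity φ a x
  linarith

theorem shiftedDelta2Const_lt_top (hφ : IsNFunction φ) (h2 : SatisfiesDelta2 φ) :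
    shiftedDelta2Const φ < ⊤ := by
  obtain ⟨C, hC0, hC⟩ := h2
  refine lt_of_le_of_lt (b := ((4 * C ^ 2).toNNReal : ℝ≥0∞)) ?_ ENNReal.coe_lt_top
  refine iSup₂_le fun a ha => iInf₂_le _ fun t ht => ?_
  rw [Real.coe_toNNReal _ (by positivity)]
  exact shifted_two_mul_le hφ hC0 hC ha ht

/-- The shifted N-functions are doubling with a constant that depends only on `c_φ`. The summand
`1` makes up for the infimum in the definition of the smallest constant. -/
theorem isDoubling_shifted (hφ : IsNFunction φ) (h2 : SatisfiesDelta2 φ) {a : ℝ} (ha : 0 ≤ a) :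
    IsDoubling ((shiftedDelta2Const φ).toReal + 1) (shifted φ a) := by
  have htop := shiftedDelta2Const_lt_top hφ h2
  have h0 : shifted φ a 0 = 0 := intervalIntegral.integral_same
  refine ⟨h0, shifted_monotoneOn hφ ha, fun t ht => ?_⟩
  have hle : delta2Const (shifted φ a) ≤ shiftedDelta2Const φ :=
    le_iSup₂ (f := fun (a : ℝ) (_ : 0 ≤ a) => delta2Const (shifted φ a)) a ha
  have hlt : delta2Const (shifted φ a) < shiftedDelta2Const φ + 1 :=
    hle.trans_lt (ENNReal.lt_add_right htop.ne one_ne_zero)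
  obtain ⟨c, hc⟩ := iInf_lt_iff.1 hlt
  obtain ⟨hcd, hc⟩ := iInf_lt_iff.1 hc
  refine (hcd t ht).trans (mul_le_mul_of_nonneg_right ?_ ?_)
  · have := ENNReal.toReal_mono (ENNReal.add_ne_top.2 ⟨htop.ne, ENNReal.one_ne_top⟩) hc.le
    rwa [ENNReal.toReal_add htop.ne ENNReal.one_ne_top, ENNReal.toReal_one,
      ENNReal.coe_toReal] at this
  · rw [← h0]
    exact shifted_monotoneOn hφ ha (mem_Ici.2 le_rfl) ht ht

end

section

variable {K : ℝ} {ψ : ℝ → ℝ}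

theorem IsDoubling.nonneg (hψ : IsDoubling K ψ) {t : ℝ} (ht : 0 ≤ t) : 0 ≤ ψ t := by
  rw [← hψ.map_zero]
  exact hψ.monotoneOn (mem_Ici.2 le_rfl) ht ht

theorem IsDoubling.map_two_pow_mul_le (hψ : IsDoubling K ψ) (hK : 0 ≤ K) (n : ℕ) {t : ℝ}
    (ht : 0 ≤ t) : ψ (2 ^ n * t) ≤ K ^ n * ψ t := by
  induction n with
  | zero => simp
  | succ n ih =>
    calc ψ (2 ^ (n + 1) * t) = ψ (2 * (2 ^ n * t)) := by ring_nf
      _ ≤ K * ψ (2 ^ n * t) := hψ.map_two_mul_le _ (by positivity)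
      _ ≤ K * (K ^ n * ψ t) := mul_le_mul_of_nonneg_left ih hK
      _ = K ^ (n + 1) * ψ t := by ring

theorem IsDoubling.measurable_comp_norm {E : Type*} [NormedAddCommGroup E]
    (hψ : IsDoubling K ψ) {X : Type*} [TopologicalSpace X] [MeasurableSpace X] [BorelSpace X]
    {p : X → E} (hp : Continuous p) : Measurable fun x => ψ ‖p x‖ := by
  have h : Monotone fun t => ψ (max t 0) := fun s t hst =>
    hψ.monotoneOn (mem_Ici.2 (le_max_right _ _)) (mem_Ici.2 (le_max_right _ _))
      (max_le_max_right 0 hst)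
  have := h.measurable.comp hp.norm.measurable
  convert this using 2 with x
  simp

end

/-! ### Averages over sides -/

/-- A simplex with `n + 1` vertices has positive and finite `n`-dimensional measure. -/
theorem hausdorffMeasure_simplex {d n : ℕ} {s : Finset (Eu d)}
    (hs : AffineIndependent ℝ ((↑) : s → Eu d)) (hcard : s.card = n + 1) :
    μH[(n : ℝ)] (simplex s) ≠ 0 ∧ μH[(n : ℝ)] (simplex s) ≠ ⊤ := by
  obtain ⟨y₀, hy₀⟩ : s.Nonempty := Finset.card_pos.1 (by omega)
  set W := (affineSpan ℝ (s : Set (Eu d))).direction with hW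
  have hfin : Module.finrank ℝ W = n := by
    have h := hs.finrank_vectorSpan (n := n) (by simp [hcard])
    rw [hW, direction_affineSpan]
    have e : range ((↑) : s → Eu d) = (s : Set (Eu d)) := Subtype.range_coe
    rw [e] at h
    exact h
  have hy₀' : y₀ ∈ affineSpan ℝ (s : Set (Eu d)) := subset_affineSpan ℝ _ (Finset.mem_coe.2 hy₀)
  let ι : W → Eu d := fun w => (w : Eu d) + y₀
  have hι : Isometry ι := Isometry.of_dist_eq fun w w' => by
    simp only [ι, dist_add_right]
    rfl
  have hrange : simplex s ⊆ range ι := by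
    intro x hx
    have hx' := simplex_subset_affineSpan s hx
    exact ⟨⟨x -ᵥ y₀, AffineSubspace.vsub_mem_direction hx' hy₀'⟩, by simp [ι]⟩
  have himg : ι '' (ι ⁻¹' simplex s) = simplex s := by
    rw [image_preimage_eq_inter_range, inter_eq_left.2 hrange]
  have hμ : μH[(n : ℝ)] (simplex s) = μH[(n : ℝ)] (ι ⁻¹' simplex s) := by
    conv_lhs => rw [← himg]
    exact hι.hausdorffMeasure_image (Or.inl (by positivity)) _
  have hcomp : IsCompact (ι ⁻¹' simplex s) :=
    hι.isClosedEmbedding.isCompact_preimage (isCompact_simplex s)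
  have hint : (interior (ι ⁻¹' simplex s)).Nonempty := by
    have hne : (simplex s).Nonempty := ⟨y₀, subset_convexHull ℝ _ (Finset.mem_coe.2 hy₀)⟩
    obtain ⟨x, hx⟩ := hne.intrinsicInterior (convex_simplex s)
    rw [mem_intrinsicInterior] at hx
    obtain ⟨x', hx', -⟩ := hx
    have hspan : affineSpan ℝ (simplex s) = affineSpan ℝ (s : Set (Eu d)) := affineSpan_convexHull _
    let j : W → affineSpan ℝ (simplex s) := fun w => ⟨(w : Eu d) + y₀, by
      rw [hspan]
      exact AffineSubspace.vadd_mem_of_mem_direction w.2 hy₀'⟩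
    have hj : Continuous j := by fun_prop
    have hxs : (x' : Eu d) ∈ affineSpan ℝ (s : Set (Eu d)) := hspan ▸ x'.2
    refine ⟨⟨(x' : Eu d) -ᵥ y₀, AffineSubspace.vsub_mem_direction hxs hy₀'⟩,
      mem_interior.2 ⟨j ⁻¹' interior ((↑) ⁻¹' simplex s), ?_, isOpen_interior.preimage hj, ?_⟩⟩
    · intro w hw
      have h : j w ∈ interior ((↑) ⁻¹' simplex s) := hw
      have h' : j w ∈ ((↑) ⁻¹' simplex s : Set (affineSpan ℝ (simplex s))) := interior_subset h
      exact h'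
    · have e : j ⟨(x' : Eu d) -ᵥ y₀, AffineSubspace.vsub_mem_direction hxs hy₀'⟩ = x' := by
        ext1
        simp [j]
      rw [mem_preimage, e]
      exact hx'
  rw [hμ, ← hfin]
  exact ⟨((isOpen_interior.measure_pos _ hint).trans_le (measure_mono interior_subset)).ne',
    hcomp.measure_lt_top.ne⟩

/-- The ratio of the contraction in `IsDoubling.le_setAverage`. -/
def contractionRatio (k : ℕ) : ℝ := (2 * (lineConst k + 1))⁻¹

theorem contractionRatio_pos (k : ℕ) : 0 < contractionRatio k := by
  have := lineConst_nonneg k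
  unfold contractionRatio
  positivity

/-- On a side, the value of a doubling function at a polynomial is bounded by its average: if `‖p‖`
is maximal at `x`, then `‖p‖` is at least half of the maximum on the image of the side under a
contraction with center `x` whose ratio depends only on the degree. -/
theorem IsDoubling.le_setAverage {K : ℝ} {ψ : ℝ → ℝ} (hψ : IsDoubling K ψ) (hK : 0 ≤ K) {d l k : ℕ}
    (hd : 1 ≤ d) {S : Finset (Eu d)} (hS : AffineIndependent ℝ ((↑) : S → Eu d))
    (hcard : S.card = d) {p : Eu d → Eu l} (hp : IsLineInterp k p) (hpc : Continuous p)
    {z : Eu d} (hz : z ∈ simplex S) :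
    contractionRatio k ^ ((d : ℝ) - 1) * ψ ‖p z‖ ≤
      K * ⨍ x in simplex S, ψ ‖p x‖ ∂(μH[(d : ℝ) - 1]) := by
  obtain ⟨hμ0, hμtop⟩ := hausdorffMeasure_simplex (n := d - 1) hS (by omega)
  have hcast : ((d - 1 : ℕ) : ℝ) = (d : ℝ) - 1 := by rw [Nat.cast_sub hd, Nat.cast_one]
  rw [hcast] at hμ0 hμtop
  set μ : Measure (Eu d) := μH[(d : ℝ) - 1] with hμ
  obtain ⟨x, hxS, hx⟩ := (isCompact_simplex S).exists_isMaxOn ⟨z, hz⟩ hpc.norm.continuousOn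
  set θ := contractionRatio k with hθ
  have hθpos : 0 < θ := contractionRatio_pos k
  have hC := lineConst_nonneg k
  have hθC : lineConst k * θ ≤ 1 / 2 := by
    rw [hθ, contractionRatio, ← div_eq_mul_inv, div_le_div_iff₀ (by positivity) two_pos]
    linarith
  have hθ1 : θ ≤ 1 := by
    rw [hθ, contractionRatio]
    exact inv_le_one_of_one_le₀ (by linarith)
  set M := ‖p x‖ with hM
  have hMle : ∀ y ∈ simplex S, ‖p y‖ ≤ M := fun y hy => hx hy
  have hint : IntegrableOn (fun y => ψ ‖p y‖) (simplex S) μ :=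
    Measure.integrableOn_of_bounded (M := ψ M) hμtop
      (hψ.measurable_comp_norm hpc).aestronglyMeasurable (by
        rw [ae_restrict_iff' (isClosed_simplex S).measurableSet]
        refine Filter.Eventually.of_forall fun y hy => ?_
        rw [Real.norm_of_nonneg (hψ.nonneg (norm_nonneg _))]
        exact hψ.monotoneOn (norm_nonneg _) (norm_nonneg _) (hMle y hy))
  set Sθ : Set (Eu d) := AffineMap.homothety x θ '' simplex S
  have hhom : ∀ y : Eu d, AffineMap.homothety x θ y = x + θ • (y - x) := fun y => by
    rw [AffineMap.homothety_apply, vsub_eq_sub, vadd_eq_add, add_comm]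
  have hsub : Sθ ⊆ simplex S := by
    rintro _ ⟨y, hy, rfl⟩
    rw [hhom]
    exact (convex_simplex S).add_smul_sub_mem hxS hy ⟨hθpos.le, hθ1⟩
  have hlow : ∀ y ∈ Sθ, ψ (M / 2) ≤ ψ ‖p y‖ := by
    rintro _ ⟨y, hy, rfl⟩
    rw [hhom]
    refine hψ.monotoneOn (mem_Ici.2 (by positivity)) (norm_nonneg _) ?_
    have h1 := hp.norm_add_smul_sub_le (x := x) (u := y - x) (M := M)
      (fun s h0 h1 => hMle _ ((convex_simplex S).add_smul_sub_mem hxS hy ⟨h0, h1⟩)) hθpos.le hθ1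
    have h2 : lineConst k * θ * M ≤ 1 / 2 * M :=
      mul_le_mul_of_nonneg_right hθC (norm_nonneg _)
    have h3 := norm_sub_norm_le (p x) (p (x + θ • (y - x)))
    rw [norm_sub_rev] at h3
    linarith
  have hclosed : IsClosed Sθ :=
    ((isCompact_simplex S).image (AffineMap.homothety_continuous x θ)).isClosed
  have hμS : μ Sθ = ‖θ‖₊ ^ ((d : ℝ) - 1) • μ (simplex S) := by
    refine hausdorffMeasure_homothety_image ?_ x hθpos.ne' _
    have : (1 : ℝ) ≤ d := by exact_mod_cast hd
    linarith
  have hμSreal : μ.real Sθ = θ ^ ((d : ℝ) - 1) * μ.real (simplex S) := by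
    rw [Measure.real, hμS, ENNReal.smul_def, smul_eq_mul, ENNReal.toReal_mul, ENNReal.coe_toReal,
      NNReal.coe_rpow, coe_nnnorm, Real.norm_of_nonneg hθpos.le]
    rfl
  have hI : ψ (M / 2) * μ.real Sθ ≤ ∫ y in simplex S, ψ ‖p y‖ ∂μ :=
    (setIntegral_ge_of_const_le_real hclosed.measurableSet
      (ne_top_of_le_ne_top hμtop (measure_mono hsub)) hlow (hint.mono_set hsub)).trans
      (setIntegral_mono_set hint
        (Filter.Eventually.of_forall fun y => hψ.nonneg (norm_nonneg _))
        (Filter.Eventually.of_forall hsub))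
  have hμpos : 0 < μ.real (simplex S) := ENNReal.toReal_pos hμ0 hμtop
  have hψM : ψ ‖p z‖ ≤ K * ψ (M / 2) := by
    refine (hψ.monotoneOn (norm_nonneg _) (norm_nonneg _) (hMle z hz)).trans ?_
    have := hψ.map_two_mul_le (M / 2) (by positivity)
    rwa [mul_div_cancel₀ _ two_ne_zero] at this
  rw [setAverage_eq, smul_eq_mul]
  rw [hμSreal] at hI
  have hI' : ψ (M / 2) * θ ^ ((d : ℝ) - 1) ≤
      (μ.real (simplex S))⁻¹ * ∫ y in simplex S, ψ ‖p y‖ ∂μ := by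
    rw [inv_mul_eq_div, le_div_iff₀ hμpos]
    linarith
  have hθd : 0 ≤ θ ^ ((d : ℝ) - 1) := Real.rpow_nonneg hθpos.le _
  calc θ ^ ((d : ℝ) - 1) * ψ ‖p z‖ ≤ θ ^ ((d : ℝ) - 1) * (K * ψ (M / 2)) :=
        mul_le_mul_of_nonneg_left hψM hθd
    _ = K * (ψ (M / 2) * θ ^ ((d : ℝ) - 1)) := by ring
    _ ≤ _ := mul_le_mul_of_nonneg_left hI' hK

/-! ### The estimate on an element -/

namespace Triangulation

variable {d l : ℕ} {Ω : Set (Eu d)} {𝒯 : Triangulation Ω}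

theorem volume_simplex_ne_zero {T : Finset (Eu d)} (hT : T ∈ 𝒯.elements) :
    volume (simplex T) ≠ 0 :=
  ((isOpen_interior.measure_pos _ (𝒯.interior_nonempty hT)).trans_le
    (measure_mono interior_subset)).ne'

theorem sidesNear_subset_sides (𝒯 : Triangulation Ω) (ΓD : Set (Eu d)) (T : Finset (Eu d)) :
    𝒯.sidesNear ΓD T ⊆ 𝒯.sides :=
  Finset.filter_subset _ _

/-- On an element `T`, the error of node averaging is a polynomial whose value at each node of `T`
is the difference of the trace from `T` and the nodal average. -/
theorem MemL.piece_sub_nodeAveraging {k : ℕ} (hk : 1 ≤ k) (ΓD : Set (Eu d)) {v : Eu d → Eu l}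
    (hv : 𝒯.MemL k v) {T : Finset (Eu d)} (hT : T ∈ 𝒯.elements) :
    IsPolyVec k (piece k (fun y => v y - 𝒯.nodeAveraging k ΓD v y) T) ∧
      ∀ z ∈ 𝒯.nodes k, z ∈ simplex T →
        piece k (fun y => v y - 𝒯.nodeAveraging k ΓD v y) T z =
          piece k v T z - 𝒯.nodalAverage k ΓD v z := by
  obtain ⟨hp, hpv⟩ := hv.piece_spec hT
  have hbasis : ∀ z ∈ 𝒯.nodes k, ∃ q : Eu d → ℝ, IsPoly k q ∧
      ∀ x ∈ simplex T, 𝒯.nodalBasis k z x = q x :=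
    fun z hz => (𝒯.nodalBasis_spec hk hz).1.2 T hT
  choose! q hq hqx using hbasis
  set Q : Eu d → Eu l := fun x => piece k v T x - ∑ z ∈ 𝒯.nodes k, q z x • 𝒯.nodalAverage k ΓD v z
  have hQ : IsPolyVec k Q := hp.sub (isPolyVec_sum_smul _ hq _)
  have hmeas : MeasurableSet (simplex T) := (isClosed_simplex T).measurableSet
  have hQv : ∀ᵐ x ∂(volume.restrict (simplex T)), v x - 𝒯.nodeAveraging k ΓD v x = Q x := by
    filter_upwards [hpv, ae_restrict_mem hmeas] with x hx hxT
    rw [hx, nodeAveraging]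
    simp only [Q]
    congr 1
    exact Finset.sum_congr rfl fun z hz => by rw [hqx z hz x hxT]
  obtain ⟨hP, hPv⟩ := Classical.epsilon_spec (p := fun p : Eu d → Eu l => IsPolyVec k p ∧
    ∀ᵐ x ∂(volume.restrict (simplex T)), v x - 𝒯.nodeAveraging k ΓD v x = p x) ⟨Q, hQ, hQv⟩
  refine ⟨hP, fun z hz hzT => ?_⟩
  have hPQ : EqOn (piece k (fun y => v y - 𝒯.nodeAveraging k ΓD v y) T) Q (simplex T) := by
    refine Measure.eqOn_of_ae_eq (μ := volume) ?_ hP.contDiff.continuous.continuousOn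
      hQ.contDiff.continuous.continuousOn (𝒯.closure_interior hT).ge
    filter_upwards [hPv, hQv] with x h1 h2
    exact h1.symm.trans h2
  rw [hPQ hzT]
  simp only [Q]
  congr 1
  rw [Finset.sum_eq_single z]
  · rw [← hqx z hz z hzT, (𝒯.nodalBasis_spec hk hz).2 z hz, if_pos rfl, one_smul]
  · intro z' hz' hne
    rw [← hqx z' hz' z hzT, (𝒯.nodalBasis_spec hk hz').2 z hz, if_neg hne.symm, zero_smul]
  · exact fun h => absurd hz h

theorem node_mem_simplex {k : ℕ} (hk : 1 ≤ k) {T : Finset (Eu d)} {α : Eu d → ℕ}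
    (hα : α ∈ T.piAntidiag k) : ∑ y ∈ T, ((α y : ℝ) / (k : ℝ)) • y ∈ simplex T := by
  have hk0 : (k : ℝ) ≠ 0 := by positivity
  refine Finset.mem_convexHull'.2 ⟨fun y => (α y : ℝ) / k, fun _ _ => by positivity, ?_, rfl⟩
  rw [← Finset.sum_div, ← Nat.cast_sum, (Finset.mem_piAntidiag.1 hα).1, div_self hk0]

theorem node_mem_nodes {k : ℕ} {T : Finset (Eu d)} (hT : T ∈ 𝒯.elements) {α : Eu d → ℕ}
    (hα : α ∈ T.piAntidiag k) : ∑ y ∈ T, ((α y : ℝ) / (k : ℝ)) • y ∈ 𝒯.nodes k :=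
  Finset.mem_biUnion.2 ⟨T, hT, Finset.mem_image_of_mem _ hα⟩

end Triangulation

theorem gradNorm_le {d l m : ℕ} {p : Eu d → Eu l} {x : Eu d} {B : ℝ} (hB : 0 ≤ B)
    (h : ∀ e : Fin m → Eu d, (∀ i, ‖e i‖ ≤ 1) → ‖iteratedFDeriv ℝ m p x e‖ ≤ B) :
    gradNorm m p x ≤ (d : ℝ) ^ m * B := by
  rw [gradNorm]
  refine Real.sqrt_le_iff.2 ⟨by positivity, ?_⟩
  have h1 : ∀ j ∈ (Finset.univ : Finset (Fin m → Fin d)),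
      ‖iteratedFDeriv ℝ m p x (fun i => EuclideanSpace.single (j i) (1 : ℝ))‖ ^ 2 ≤ B ^ 2 :=
    fun j _ => pow_le_pow_left₀ (norm_nonneg _) (h _ fun i => by simp) 2
  refine (Finset.sum_le_card_nsmul _ _ _ h1).trans ?_
  rw [Finset.card_univ, Fintype.card_fun, Fintype.card_fin, Fintype.card_fin, nsmul_eq_mul, mul_pow]
  push_cast
  refine mul_le_mul_of_nonneg_right ?_ (sq_nonneg B)
  -- `d ^ m` is a natural number and hence at most its square.
  have : d ^ m ≤ (d ^ m) ^ 2 := Nat.le_self_pow two_ne_zero _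
  exact_mod_cast this

/-- The factor by which the derivatives of the error on an element may exceed the jumps across the
sides near it. -/
def errorConst (d k : ℕ) (κ : ℝ) : ℝ :=
  (1 + d * (8 * |κ| * lineConst k)) ^ (k + 1) *
    (((k : ℝ) + 1) ^ (d + 1) * (k : ℝ) ^ k * ((4 * |κ|) ^ d + 1))

theorem Triangulation.diam_pow_mul_gradNorm_le {d k l : ℕ} (hd : 1 ≤ d) (hk : 1 ≤ k) {κ : ℝ}
    {Ω : Set (Eu d)} (hΩ : IsLipschitzDomain Ω) {ΓD : Set (Eu d)} (hΓ : ΓD ⊆ frontier Ω)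
    {𝒯 : Triangulation Ω} (hκ : 𝒯.ShapeRegular κ) (hres : 𝒯.Resolves ΓD) {v : Eu d → Eu l}
    (hv : 𝒯.MemL k v) {m : ℕ} (hm : m ≤ k + 1) {T : Finset (Eu d)} (hT : T ∈ 𝒯.elements)
    {R : ℝ} (hR : 0 ≤ R)
    (hjump : ∀ S ∈ 𝒯.sidesNear ΓD T, IsPolyVec k (𝒯.jump k v S) →
      ∀ z ∈ simplex S, ‖𝒯.jump k v S z‖ ≤ R) {x : Eu d} (hx : x ∈ simplex T) :
    Metric.diam (simplex T) ^ m *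
      gradNorm m (piece k (fun y => v y - 𝒯.nodeAveraging k ΓD v y) T) x ≤
        errorConst d k κ * R := by
  obtain ⟨hP, hPz⟩ := hv.piece_sub_nodeAveraging hk ΓD hT
  set P := piece k (fun y => v y - 𝒯.nodeAveraging k ΓD v y) T
  obtain ⟨hκ0, x₀, hball⟩ := hκ.exists_closedBall_subset hd hT
  have hdiam := 𝒯.diam_pos hd hT
  set h := Metric.diam (simplex T)
  have hC := lineConst_nonneg k
  have hnode : ∀ α ∈ T.piAntidiag k,
      ‖P (∑ y ∈ T, ((α y : ℝ) / (k : ℝ)) • y)‖ ≤ ((4 * κ) ^ d + 1) * R := by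
    intro α hα
    have hzT := node_mem_simplex hk hα
    rw [hPz _ (node_mem_nodes hT hα) hzT]
    refine (𝒯.norm_piece_sub_nodalAverage_le hd hΩ hΓ hres hv hT hzT hR
      fun S hS hSp => hjump S hS hSp _).trans (mul_le_mul_of_nonneg_right ?_ hR)
    have := hκ.card_elementsAt_le hd ⟨T, 𝒯.mem_elementsAt.2 ⟨hT, hzT⟩⟩
    linarith
  set M : ℝ := ((k : ℝ) + 1) ^ (d + 1) * (k : ℝ) ^ k * (((4 * κ) ^ d + 1) * R) with hM
  have hM0 : 0 ≤ M := by positivity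
  have hsup : ∀ y ∈ simplex T, ‖P y‖ ≤ M := by
    intro y hy
    have := hP.norm_le_of_nodes hk T hnode hy
    rwa [(𝒯.mem_elements.1 hT).2] at this
  have hgrad := gradNorm_le (m := m) (p := P) (x := x) (B := (8 * κ * lineConst k) ^ m * M / h ^ m)
    (by positivity) fun e he => by
      have h1 := IsLineInterp.norm_iteratedFDeriv_le (convex_simplex T) (by positivity) hball m
        (hP.isLineInterp hk) hP.contDiff hM0 hsup hx e he
      rw [le_div_iff₀ (by positivity)]
      calc ‖iteratedFDeriv ℝ m P x e‖ * h ^ m =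
            (4 * κ) ^ m * ((h / (4 * κ)) ^ m * ‖iteratedFDeriv ℝ m P x e‖) := by
            rw [div_pow]
            field_simp
        _ ≤ (4 * κ) ^ m * ((2 * lineConst k) ^ m * M) := by gcongr
        _ = (8 * κ * lineConst k) ^ m * M := by
            rw [← mul_assoc, ← mul_pow]
            ring_nf
  calc h ^ m * gradNorm m P x
      ≤ h ^ m * ((d : ℝ) ^ m * ((8 * κ * lineConst k) ^ m * M / h ^ m)) := by gcongr
    _ = (d * (8 * κ * lineConst k)) ^ m * M := by
        rw [mul_pow (d : ℝ)]
        generalize (8 * κ * lineConst k) ^ m = B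
        field_simp
    _ ≤ (1 + d * (8 * κ * lineConst k)) ^ (k + 1) * M := by
        have h0 : 0 ≤ (d : ℝ) * (8 * κ * lineConst k) := by positivity
        refine mul_le_mul_of_nonneg_right ?_ hM0
        exact (pow_le_pow_left₀ h0 (by linarith) m).trans
          (pow_le_pow_right₀ (by linarith) hm)
    _ = errorConst d k κ * R := by
        rw [errorConst, abs_of_pos hκ0, hM]
        ring

/-- For the largest jump `R` at the points of the given sides, `ψ R` is bounded by the sum of the
averages of `ψ` of the jumps over these sides. Sides with a nonpolynomial jump are left out, since
the choices in the definition of the jump mean nothing for a side without adjacent elements. -/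
theorem exists_jump_bound {d l k : ℕ} (hd : 1 ≤ d) (hk : 1 ≤ k) {K : ℝ} (hK : 0 ≤ K) {ψ : ℝ → ℝ}
    (hψ : IsDoubling K ψ) (F : Finset (Finset (Eu d)))
    (hF : ∀ S ∈ F, AffineIndependent ℝ ((↑) : S → Eu d) ∧ S.card = d)
    (j : Finset (Eu d) → Eu d → Eu l) :
    ∃ R, 0 ≤ R ∧ (∀ S ∈ F, IsPolyVec k (j S) → ∀ z ∈ simplex S, ‖j S z‖ ≤ R) ∧
      contractionRatio k ^ ((d : ℝ) - 1) * ψ R ≤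
        K * ∑ S ∈ F, ⨍ x in simplex S, ψ ‖j S x‖ ∂(μH[(d : ℝ) - 1]) := by
  have hterm : ∀ S ∈ F, 0 ≤ ⨍ x in simplex S, ψ ‖j S x‖ ∂(μH[(d : ℝ) - 1]) := fun S _ => by
    rw [setAverage_eq, smul_eq_mul]
    exact mul_nonneg (inv_nonneg.2 measureReal_nonneg)
      (integral_nonneg fun x => hψ.nonneg (norm_nonneg _))
  let G := F.filter fun S => IsPolyVec k (j S)
  rcases G.eq_empty_or_nonempty with hG | hG
  · refine ⟨0, le_rfl, fun S hS hSp => ?_, ?_⟩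
    · have : S ∈ G := Finset.mem_filter.2 ⟨hS, hSp⟩
      rw [hG] at this
      exact absurd this (Finset.notMem_empty S)
    · rw [hψ.map_zero, mul_zero]
      exact mul_nonneg hK (Finset.sum_nonneg hterm)
  have hmax : ∀ S ∈ G, ∃ x ∈ simplex S, ∀ z ∈ simplex S, ‖j S z‖ ≤ ‖j S x‖ := by
    intro S hS
    obtain ⟨hSF, hSp⟩ := Finset.mem_filter.1 hS
    have hne : S.Nonempty := Finset.card_pos.1 (by rw [(hF S hSF).2]; exact hd)
    exact (isCompact_simplex S).exists_isMaxOn ⟨_, barycenter_mem hne⟩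
      hSp.contDiff.continuous.norm.continuousOn
  choose! x hxS hx using hmax
  obtain ⟨S, hS, hSmax⟩ := G.exists_max_image (fun S => ‖j S (x S)‖) hG
  obtain ⟨hSF, hSp⟩ := Finset.mem_filter.1 hS
  refine ⟨‖j S (x S)‖, norm_nonneg _, fun S' hS' hSp' z hz => ?_, ?_⟩
  · have hS'G : S' ∈ G := Finset.mem_filter.2 ⟨hS', hSp'⟩
    exact (hx S' hS'G z hz).trans (hSmax S' hS'G)
  · refine (hψ.le_setAverage hK hd (hF S hSF).1 (hF S hSF).2 (hSp.isLineInterp hk)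
      hSp.contDiff.continuous (hxS S hS)).trans (mul_le_mul_of_nonneg_left ?_ hK)
    exact Finset.single_le_sum
      (f := fun S => ⨍ x in simplex S, ψ ‖j S x‖ ∂(μH[(d : ℝ) - 1])) hterm hSF

/-- Without measurability of `f` the average is `0`, and the bound still holds. -/
theorem setAverage_le_of_le {X : Type*} [MeasurableSpace X] {μ : Measure X} {s : Set X}
    (hs0 : μ s ≠ 0) (hs : μ s ≠ ⊤) {f : X → ℝ} {B : ℝ} (hf0 : ∀ x ∈ s, 0 ≤ f x)
    (hf : ∀ x ∈ s, f x ≤ B) : ⨍ x in s, f x ∂μ ≤ B := by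
  have hpos : 0 < μ.real s := ENNReal.toReal_pos hs0 hs
  rw [setAverage_eq, smul_eq_mul, inv_mul_eq_div, div_le_iff₀ hpos]
  refine (Real.le_norm_self _).trans (norm_setIntegral_le_of_norm_le_const hs.lt_top fun x hx => ?_)
  rw [Real.norm_of_nonneg (hf0 x hx)]
  exact hf x hx

end

end NodeAveraging

theorem mainTheorem8 (d k l : ℕ) (hd : 1 ≤ d) (hk : 1 ≤ k) (κ : ℝ) :
    ∃ c : ENNReal → ℝ, (∀ s, 0 < c s) ∧
      ∀ φ : ℝ → ℝ, NodeAveraging.IsNFunction φ → NodeAveraging.SatisfiesDelta2 φ →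
        NodeAveraging.SatisfiesNabla2 φ →
      ∀ Ω : Set (EuclideanSpace ℝ (Fin d)), NodeAveraging.IsLipschitzDomain Ω →
      ∀ ΓD : Set (EuclideanSpace ℝ (Fin d)), ΓD ⊆ frontier Ω → IsClosed ΓD →
      ∀ 𝒯 : NodeAveraging.Triangulation Ω, 𝒯.ShapeRegular κ → 𝒯.Resolves ΓD →
      ∀ v : EuclideanSpace ℝ (Fin d) → EuclideanSpace ℝ (Fin l), 𝒯.MemL k v →
      ∀ m : ℕ, 1 ≤ m → m ≤ k + 1 → ∀ a : ℝ, 0 ≤ a → ∀ T ∈ 𝒯.elements,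
        (⨍ x in NodeAveraging.simplex T,
            NodeAveraging.shifted φ a
              (Metric.diam (NodeAveraging.simplex T) ^ m *
                NodeAveraging.gradNorm m
                  (NodeAveraging.piece k (fun y => v y - 𝒯.nodeAveraging k ΓD v y) T) x))
          ≤ c (NodeAveraging.shiftedDelta2Const φ) *
            ∑ S ∈ 𝒯.sidesNear ΓD T,
              ⨍ x in NodeAveraging.simplex S,
                NodeAveraging.shifted φ a ‖𝒯.jump k v S x‖ ∂(μH[(d : ℝ) - 1]) := by
  -- A power of two is taken, so that `q` steps of doubling absorb the constant.
  obtain ⟨q, hq⟩ := pow_unbounded_of_one_lt (NodeAveraging.errorConst d k κ) one_lt_two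
  have hθ : 0 < NodeAveraging.contractionRatio k ^ ((d : ℝ) - 1) :=
    Real.rpow_pos_of_pos (NodeAveraging.contractionRatio_pos k) _
  refine ⟨fun s => (s.toReal + 1) ^ (q + 1) / NodeAveraging.contractionRatio k ^ ((d : ℝ) - 1),
    fun s => by positivity, ?_⟩
  intro φ hφ hφ2 _ Ω hΩ ΓD hΓ _ 𝒯 hκ hres v hv m _ hm a ha T hT
  have hψ := NodeAveraging.isDoubling_shifted hφ hφ2 ha
  set K : ℝ := (NodeAveraging.shiftedDelta2Const φ).toReal + 1 with hKdef
  have hK : 0 ≤ K := by positivity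
  obtain ⟨R, hR0, hRjump, hRψ⟩ := NodeAveraging.exists_jump_bound hd hk hK hψ
    (𝒯.sidesNear ΓD T) (fun S hS => by
      have h := 𝒯.mem_sides.1 (𝒯.sidesNear_subset_sides ΓD T hS)
      exact ⟨𝒯.complex.indep h.1, h.2⟩) (𝒯.jump k v)
  set J := ∑ S ∈ 𝒯.sidesNear ΓD T, ⨍ x in NodeAveraging.simplex S,
    NodeAveraging.shifted φ a ‖𝒯.jump k v S x‖ ∂(μH[(d : ℝ) - 1])
  have hbound : NodeAveraging.shifted φ a (2 ^ q * R) ≤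
      K ^ (q + 1) / NodeAveraging.contractionRatio k ^ ((d : ℝ) - 1) * J := by
    rw [div_mul_eq_mul_div, le_div_iff₀ hθ]
    have h1 := mul_le_mul_of_nonneg_right (hψ.map_two_pow_mul_le hK q hR0) hθ.le
    have h2 := mul_le_mul_of_nonneg_left hRψ (pow_nonneg hK q)
    rw [pow_succ]
    linarith
  have hnn : ∀ x, 0 ≤ Metric.diam (NodeAveraging.simplex T) ^ m * NodeAveraging.gradNorm m
      (NodeAveraging.piece k (fun y => v y - 𝒯.nodeAveraging k ΓD v y) T) x := fun x =>
    mul_nonneg (pow_nonneg Metric.diam_nonneg m) (Real.sqrt_nonneg _)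
  refine NodeAveraging.setAverage_le_of_le
    (NodeAveraging.Triangulation.volume_simplex_ne_zero hT)
    (NodeAveraging.isCompact_simplex T).measure_lt_top.ne (fun x _ => hψ.nonneg (hnn x))
    fun x hx => (hψ.monotoneOn (hnn x) (Set.mem_Ici.2 (by positivity)) ?_).trans hbound
  exact (NodeAveraging.Triangulation.diam_pow_mul_gradNorm_le hd hk hΩ hΓ hκ hres hv hm hT hR0
    hRjump hx).trans (mul_le_mul_of_nonneg_right hq.le hR0)
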